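/- Theorem 5.1. Let $n,k\ge 0$ be integers, let $M$ be a complex manifold of complex dimension $n+k$ with complex structure $J$ on its real tangent bundle $TM$, and for a smooth vector valued function $U$ put $d^cU(v)=-dU(Jv)$. Let $\rho$ be an $\mathbb R$-linear map from $\mathbb R^k$ to the vector fields on $M$ and let $U:M\to\mathbb R^k$ be a map such that $(\mathbb R^k,\rho,U)$ is a complex gradient system, that is: $U$ is smooth; for every $V\in\mathbb R^k$ the vector field $\rho(V)$ is smooth and satisfies $dU(\rho(V))=0$ and $d^cU(\rho(V))=V$; and the distribution on $M$ spanned by the vector fields $\rho(V)$ and $J\rho(V)$, $V\in\mathbb R^k$, is integrable. Put $\rho^{\mathbb C}(V)=\tfrac12\bigl(\rho(V)-iJ\rho(V)\bigr)$. Assume that the system is holomorphic, that is, $\rho^{\mathbb C}(V)$ is a holomorphic vector field (of type $(1,0)$) on $M$ for each $V\in\mathbb R^k$, and abelian, that is, $\bigl[\rho^{\mathbb C}(V),\overline{\rho^{\mathbb C}(W)}\bigr]=0$ for all $V,W\in\mathbb R^k$. Then for each point $p\in M$ there exist holomorphic coordinates $z=(z_1,\dots,z_n)$, $w=(w_1,\dots,w_k)$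 on an open neighbourhood of $p$, with $z=x+iy$ and $w=t+iu$ ($x,y\in\mathbb R^n$, $t,u\in\mathbb R^k$), and a smooth function $F$ with values in $\mathbb R^k$, defined on the open set of $\mathbb C^n$ of all values taken by the coordinates $z$ and so depending only on $x$ and $y$, such that on this neighbourhood $$\rho(e_\alpha)=\frac{\partial}{\partial t_\alpha}\quad(\alpha=1,\dots,k),\qquad U(z,w)=F(x,y)-u,$$ where $e_1,\dots,e_k$ is the canonical basis of $\mathbb R^k$. -/

import Mathlib

open scoped Manifold ContDiff

/-- A complex manifold is, by restriction of scalars, a real manifold of the same regularity.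
Every real notion below (tangent bundle, differential, smoothness) refers to this structure. -/
instance IsManifold.realOfComplex {E : Type*} [NormedAddCommGroup E] [NormedSpace ℂ E]
    {M : Type*} [TopologicalSpace M] [ChartedSpace E M] {n : ℕ∞ω}
    [h : IsManifold 𝓘(ℂ, E) n M] : IsManifold 𝓘(ℝ, E) n M :=
  isManifold_of_contDiffOn 𝓘(ℝ, E) n M fun _ _ he he' =>
    ((contDiffGroupoid n 𝓘(ℂ, E)).compatible he he').1.restrict_scalars ℝ

namespace ComplexGradient

noncomputable section

section VectorFields

variable {E : Type*} [NormedAddCommGroup E] [NormedSpace ℂ E]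
  {M : Type*} [TopologicalSpace M] [ChartedSpace E M]

/-- The complex structure `J` on the real tangent space of a complex manifold: multiplication by
`i` in a holomorphic chart (the choice of the chart does not matter, since the differentials of the
transition maps are complex linear). -/
def J (q : M) : TangentSpace 𝓘(ℝ, E) q →ₗ[ℝ] TangentSpace 𝓘(ℝ, E) q :=
  (Complex.I • (LinearMap.id : E →ₗ[ℂ] E)).restrictScalars ℝ

/-- The field `J X` for a real vector field `X`. -/
def JField (X : ∀ q : M, TangentSpace 𝓘(ℝ, E) q) : ∀ q : M, TangentSpace 𝓘(ℝ, E) q :=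
  fun q => J q (X q)

/-- The operator `dᶜ` on vector valued functions: `dᶜU(v) = -dU(Jv)`. -/
def dc {V : Type*} [NormedAddCommGroup V] [NormedSpace ℝ V] (U : M → V) (q : M)
    (v : TangentSpace 𝓘(ℝ, E) q) : V :=
  -(mfderiv 𝓘(ℝ, E) 𝓘(ℝ, V) U q (J q v))

variable (E M) in
/-- A section `re + i im` of the complexified tangent bundle `ℂ ⊗ TM = TM ⊕ i TM`. -/
@[ext]
structure ComplexVectorField where
  /-- the real part -/
  re : ∀ q : M, TangentSpace 𝓘(ℝ, E) q
  /-- the imaginary part -/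
  im : ∀ q : M, TangentSpace 𝓘(ℝ, E) q

instance : Zero (ComplexVectorField E M) := ⟨⟨0, 0⟩⟩

/-- The complex conjugate of a complex vector field. -/
def ComplexVectorField.conj (Z : ComplexVectorField E M) : ComplexVectorField E M :=
  ⟨Z.re, -Z.im⟩

/-- The Lie bracket of complex vector fields: the complex bilinear extension of the Lie bracket of
real vector fields. -/
def ComplexVectorField.bracket (Z W : ComplexVectorField E M) : ComplexVectorField E M where
  re := VectorField.mlieBracket 𝓘(ℝ, E) Z.re W.re - VectorField.mlieBracket 𝓘(ℝ, E) Z.im W.im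
  im := VectorField.mlieBracket 𝓘(ℝ, E) Z.re W.im + VectorField.mlieBracket 𝓘(ℝ, E) Z.im W.re

/-- `Z` is of type `(1,0)`: the complex linear extension of `J` satisfies `J Z = i Z`. -/
def ComplexVectorField.IsType10 (Z : ComplexVectorField E M) : Prop :=
  ∀ q : M, J q (Z.re q) = -(Z.im q) ∧ J q (Z.im q) = Z.re q

/-- The derivative `Z e = de(re Z) + i de(im Z)` of a chart `e` along `Z`. If `Z` is of type
`(1,0)`, it is the vector of the coefficients `aⱼ` in the expression `Z = ∑ⱼ aⱼ ∂/∂zⱼ` with respect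
to the coordinates given by `e`. -/
def ComplexVectorField.coeff (Z : ComplexVectorField E M) (e : OpenPartialHomeomorph M E)
    (q : M) : E :=
  let d : TangentSpace 𝓘(ℝ, E) q → E := fun v => mfderiv 𝓘(ℝ, E) 𝓘(ℝ, E) e q v
  d (Z.re q) + Complex.I • d (Z.im q)

/-- A holomorphic vector field: of type `(1,0)`, with holomorphic coefficients with respect to every
holomorphic coordinate system. -/
def ComplexVectorField.IsHolomorphic (Z : ComplexVectorField E M) : Prop :=
  Z.IsType10 ∧
    ∀ e ∈ IsManifold.maximalAtlas 𝓘(ℂ, E) ω M,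
      MDifferentiableOn 𝓘(ℂ, E) 𝓘(ℂ, E) (Z.coeff e) e.source

/-- A distribution `D` (a family of subspaces of the real tangent spaces) is integrable if around
every point there are smooth real coordinates in which `D` is a constant subspace, so that the
slices parallel to this subspace are integral manifolds of `D`. -/
def IsIntegrable (D : ∀ q : M, Submodule ℝ (TangentSpace 𝓘(ℝ, E) q)) : Prop :=
  ∀ p : M, ∃ e ∈ IsManifold.maximalAtlas 𝓘(ℝ, E) ∞ M, p ∈ e.source ∧
    ∃ S : Submodule ℝ E, ∀ q ∈ e.source, ∀ v : TangentSpace 𝓘(ℝ, E) q,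
      v ∈ D q ↔ (mfderiv 𝓘(ℝ, E) 𝓘(ℝ, E) e q v : E) ∈ S

end VectorFields

section GradientSystems

variable {E : Type*} [NormedAddCommGroup E] [NormedSpace ℂ E]
  {M : Type*} [TopologicalSpace M] [ChartedSpace E M]
  {V : Type*} [NormedAddCommGroup V] [NormedSpace ℝ V]

/-- The distribution spanned by the vector fields `ρ(v)` and `J ρ(v)`. -/
def complexDistribution (ρ : V →ₗ[ℝ] (∀ q : M, TangentSpace 𝓘(ℝ, E) q)) (q : M) :
    Submodule ℝ (TangentSpace 𝓘(ℝ, E) q) :=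
  Submodule.span ℝ (Set.range (fun v : V => ρ v q) ∪ Set.range (fun v : V => J q (ρ v q)))

/-- `(V, ρ, U)` is a complex gradient system on the complex manifold `M`; its dimension is the real
dimension of `V`. -/
structure IsComplexGradientSystem [IsManifold 𝓘(ℂ, E) ω M] [FiniteDimensional ℝ V]
    (ρ : V →ₗ[ℝ] (∀ q : M, TangentSpace 𝓘(ℝ, E) q)) (U : M → V) : Prop where
  smooth_gradient : ContMDiff 𝓘(ℝ, E) 𝓘(ℝ, V) ∞ U
  smooth_field : ∀ v : V, ContMDiff 𝓘(ℝ, E) 𝓘(ℝ, E).tangent ∞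
    (fun q : M => (⟨q, ρ v q⟩ : TangentBundle 𝓘(ℝ, E) M))
  d_eq : ∀ (v : V) (q : M), mfderiv 𝓘(ℝ, E) 𝓘(ℝ, V) U q (ρ v q) = 0
  dc_eq : ∀ (v : V) (q : M), dc U q (ρ v q) = v
  integrable : IsIntegrable (complexDistribution ρ)

/-- The complexified representation `ρᶜ(v) = (ρ(v) - i J ρ(v)) / 2`. -/
def complexified (ρ : V →ₗ[ℝ] (∀ q : M, TangentSpace 𝓘(ℝ, E) q)) (v : V) :
    ComplexVectorField E M :=
  ⟨(1 / 2 : ℝ) • ρ v, -((1 / 2 : ℝ) • JField (ρ v))⟩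

/-- The system is holomorphic: every `ρᶜ(v)` is a holomorphic vector field. -/
def IsHolomorphicSystem (ρ : V →ₗ[ℝ] (∀ q : M, TangentSpace 𝓘(ℝ, E) q)) : Prop :=
  ∀ v : V, (complexified ρ v).IsHolomorphic

/-- The system is abelian: `ρᶜ(v)` commutes with the conjugate of `ρᶜ(w)`, for all `v` and `w`. -/
def IsAbelianSystem (ρ : V →ₗ[ℝ] (∀ q : M, TangentSpace 𝓘(ℝ, E) q)) : Prop :=
  ∀ v w : V, (complexified ρ v).bracket (complexified ρ w).conj = 0

end GradientSystems

section Coordinates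

variable {n k : ℕ}

/-- The first `n` coordinates `z` of a point of `ℂⁿ⁺ᵏ`. -/
def zPart (c : EuclideanSpace ℂ (Fin (n + k))) : EuclideanSpace ℂ (Fin n) :=
  WithLp.toLp 2 fun i => c (Fin.castAdd k i)

/-- The last `k` coordinates `w = t + i u` of a point of `ℂⁿ⁺ᵏ`. -/
def wPart (c : EuclideanSpace ℂ (Fin (n + k))) : EuclideanSpace ℂ (Fin k) :=
  WithLp.toLp 2 fun i => c (Fin.natAdd n i)

/-- The imaginary part `u` of the last `k` coordinates `w = t + i u`. -/
def uPart (c : EuclideanSpace ℂ (Fin (n + k))) : EuclideanSpace ℝ (Fin k) :=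
  WithLp.toLp 2 fun i => (wPart c i).im

/-- The coordinate vector `∂/∂t_α` of `ℂⁿ⁺ᵏ`, where `w_α = t_α + i u_α`. -/
def tVector (α : Fin k) : EuclideanSpace ℂ (Fin (n + k)) :=
  EuclideanSpace.single (Fin.natAdd n α) 1

/-- `ξ = ∂/∂t_α` on the domain of the coordinate system `e`: the differential of `e` maps `ξ` to the
coordinate vector `∂/∂t_α`. -/
def IsPartialT {M : Type*} [TopologicalSpace M]
    [ChartedSpace (EuclideanSpace ℂ (Fin (n + k))) M]
    (e : OpenPartialHomeomorph M (EuclideanSpace ℂ (Fin (n + k)))) (α : Fin k)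
    (ξ : ∀ q : M, TangentSpace 𝓘(ℝ, EuclideanSpace ℂ (Fin (n + k))) q) : Prop :=
  ∀ q ∈ e.source, mfderiv 𝓘(ℝ, EuclideanSpace ℂ (Fin (n + k)))
    𝓘(ℝ, EuclideanSpace ℂ (Fin (n + k))) e q (ξ q) = tVector α

end Coordinates

end

end ComplexGradient

/-! In a holomorphic chart `c` the differential is complex linear, so the coefficient vector of the
(1,0) field ρᶜ(v) is just the chart expression X_v of the real field ρ(v). Holomorphy of the system
says that each X_v is a holomorphic map, and the gradient equations become dU(X_v) = 0, dU(iX_v) =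
-v.

These fields commute (`IsLocalGradientSystem.commute`). The map dU is constant along X_v, X_w and
iX_w, hence kills [X_v, X_w] and [X_v, iX_w] = i[X_v, X_w]. Integrability puts the bracket in the
span of the X_a and iX_b, and there dU(ξ) = dU(iξ) = 0 forces ξ = 0.

Extend X complex linearly to ℂᵏ. At every point this extension is injective, again by the gradient
equations. Let Ψ(x, w) be the time-one flow of the field X·w starting at x. Commutation gives ∂Ψ/∂w
= X(Ψ), so Ψ restricted to a linear transversal of the span is a local biholomorphism Φ(z, w) with
∂Φ/∂w_α = X_α (`exists_straightening`). In these coordinates the w-derivative of U is -Im, so U + u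
is independent of w on a polydisc and equals F(z) = U(Φ(z, 0)).

The analytic input is the holomorphic dependence of the flow on (x, w). It comes from the implicit
function theorem for the integral equation in the Banach space C([0,1], E)
(`exists_flow_of_commute`), which needs composition operators to be complex differentiable and
complex differentiable maps to be C¹; both rest on Cauchy estimates. Osgood's lemma then upgrades Φ
to an analytic map. -/

open Metric Set Filter Topology

/-! ### Cauchy estimates for holomorphic maps between normed spaces. -/

section ComplexDifferentiable

variable {E F : Type*} [NormedAddCommGroup E] [NormedSpace ℂ E]
  [NormedAddCommGroup F] [NormedSpace ℂ F]

/-- The second order Taylor estimate for a complex differentiable function. -/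
theorem DifferentiableOn.norm_sub_fderiv_le {f : E → F} {c z : E} {R M : ℝ}
    (hd : DifferentiableOn ℂ f (ball c R)) (hm : MapsTo f (ball c R) (closedBall (f c) M))
    (hz : z ∈ ball c R) :
    ‖f z - f c - fderiv ℂ f c (z - c)‖ ≤ 2 * M * (‖z - c‖ / R) ^ 2 := by
  have hR : 0 < R := nonempty_ball.1 ⟨z, hz⟩
  have hM : 0 ≤ M := nonempty_closedBall.1 ⟨_, hm hz⟩
  have hfc : HasFDerivAt f (fderiv ℂ f c) c :=
    (hd.differentiableAt (ball_mem_nhds _ hR)).hasFDerivAt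
  have hn : ‖fderiv ℂ f c‖ ≤ M / R := Complex.norm_fderiv_le_div_of_mapsTo_ball hd hm hR
  -- Without its linear term f agrees with its value at c to second order. The Cauchy estimate
  -- bounds the removed term by M on the ball, whence 2M, and the higher order Schwarz lemma
  -- supplies the quadratic factor.
  set g : E → F := fun y => f y - fderiv ℂ f c (y - c) with hg
  have hgd : DifferentiableOn ℂ g (ball c R) := by
    apply hd.sub
    fun_prop
  have hgc : g c = f c := by simp [hg]
  have hgm : MapsTo g (ball c R) (closedBall (g c) (2 * M)) := by
    intro y hy
    have h1 : ‖f y - f c‖ ≤ M := by simpa [dist_eq_norm] using hm hy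
    have h2 : ‖fderiv ℂ f c (y - c)‖ ≤ M := by
      refine ((fderiv ℂ f c).le_opNorm _).trans ?_
      have h3 : ‖y - c‖ ≤ R := by simpa [dist_eq_norm] using (mem_ball.1 hy).le
      calc _ ≤ M / R * R := by gcongr
        _ = M := by field_simp
    rw [mem_closedBall, hgc, dist_eq_norm]
    have : g y - f c = (f y - f c) - fderiv ℂ f c (y - c) := by simp only [hg]; abel
    rw [this]
    exact (norm_sub_le _ _).trans (by linarith)
  have key := Complex.dist_le_mul_div_pow_of_mapsTo_ball_of_isLittleO (n := 1) hgd hgm (by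
    have := hfc.isLittleO
    rw [hgc]
    refine (this.congr (fun y => ?_) (fun y => rfl)).norm_right.congr_right (by simp)
    simp only [hg]; abel) hz
  rw [hgc, dist_eq_norm, dist_eq_norm] at key
  have e : g z - f c = f z - f c - fderiv ℂ f c (z - c) := by simp only [hg]; abel
  rwa [e] at key

/-- The derivative of a complex differentiable function is continuous. -/
theorem DifferentiableOn.continuousOn_fderiv_complex {f : E → F} {s : Set E} (hs : IsOpen s)
    (hf : DifferentiableOn ℂ f s) : ContinuousOn (fderiv ℂ f) s := by
  intro x hx
  refine ContinuousAt.continuousWithinAt ?_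
  rw [Metric.continuousAt_iff]
  intro ε hε
  have hfx := (hf.differentiableAt (hs.mem_nhds hx)).hasFDerivAt
  -- Subtracting the derivative at x leaves a map within (ε/8)r of its value at x on the r-ball. Its
  -- oscillation is at most (ε/4)r, and Cauchy's estimate on a ball of radius r/2 about z bounds the
  -- difference of derivatives by ε/2.
  have h1 := hfx.isLittleO.def (show 0 < ε / 8 by positivity)
  obtain ⟨r, hr, hball⟩ := Metric.eventually_nhds_iff_ball.1 (h1.and (hs.mem_nhds hx))
  refine ⟨r / 2, by positivity, fun {z} hz => ?_⟩
  set g : E → F := fun y => f y - fderiv ℂ f x y with hg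
  have hsub : ball z (r / 2) ⊆ ball x r := by
    apply ball_subset_ball'
    linarith [mem_ball.1 hz]
  have hgd : DifferentiableOn ℂ g (ball z (r / 2)) := by
    apply DifferentiableOn.sub
    · exact hf.mono fun y hy => (hball y (hsub hy)).2
    · fun_prop
  have hgx : ∀ y ∈ ball x r, ‖g y - g x‖ ≤ ε / 8 * r := by
    intro y hy
    have h2 := (hball y hy).1
    have h3 : ‖y - x‖ ≤ r := by simpa [dist_eq_norm] using (mem_ball.1 hy).le
    have : g y - g x = f y - f x - fderiv ℂ f x (y - x) := by simp only [hg, map_sub]; abel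
    rw [this]
    exact h2.trans (by gcongr)
  have hzx : z ∈ ball x r := hsub (mem_ball_self (by positivity))
  have hgm : MapsTo g (ball z (r / 2)) (closedBall (g z) (ε / 4 * r)) := by
    intro y hy
    rw [mem_closedBall, dist_eq_norm]
    have := norm_sub_le (g y - g x) (g z - g x)
    have e : g y - g x - (g z - g x) = g y - g z := by abel
    rw [e] at this
    linarith [hgx y (hsub hy), hgx z hzx]
  have h4 := Complex.norm_fderiv_le_div_of_mapsTo_ball hgd hgm (by positivity)
  have hfz : HasFDerivAt f (fderiv ℂ f z) z :=
    (hf.differentiableAt (hs.mem_nhds (hball z hzx).2)).hasFDerivAt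
  have h5 : fderiv ℂ g z = fderiv ℂ f z - fderiv ℂ f x :=
    (hfz.sub (fderiv ℂ f x).hasFDerivAt).fderiv
  rw [h5] at h4
  rw [dist_eq_norm]
  refine h4.trans_lt ?_
  have : ε / 4 * r / (r / 2) = ε / 2 := by field_simp; norm_num
  rw [this]; linarith

theorem DifferentiableOn.contDiffOn_one_complex {f : E → F} {s : Set E} (hs : IsOpen s)
    (hf : DifferentiableOn ℂ f s) : ContDiffOn ℂ 1 f s :=
  by
  rw [show (1 : WithTop ℕ∞) = 0 + 1 by norm_num, contDiffOn_succ_iff_fderiv_of_isOpen hs]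
  exact ⟨hf, by simp, contDiffOn_zero.2 (hf.continuousOn_fderiv_complex hs)⟩

end ComplexDifferentiable

/-! ### Composition, multiplication and integration operators on C(K, E). -/

namespace ContinuousMap

section CompOp

variable {K : Type*} [TopologicalSpace K] {E F : Type*} [NormedAddCommGroup E]
  [NormedAddCommGroup F]

open Classical in
/-- The composition operator `φ ↦ f ∘ φ`; its value is zero if `f ∘ φ` is not continuous. -/
noncomputable def compOp (f : E → F) (φ : C(K, E)) : C(K, F) :=
  if h : Continuous (f ∘ φ) then ⟨f ∘ φ, h⟩ else 0

theorem compOp_apply {f : E → F} {s : Set E} (hf : ContinuousOn f s) {φ : C(K, E)}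
    (hφ : ∀ κ, φ κ ∈ s) (κ : K) : compOp f φ κ = f (φ κ) := by
  have : Continuous (f ∘ φ) := hf.comp_continuous φ.continuous hφ
  simp [compOp, this]

theorem isOpen_setOf_forall_mem [CompactSpace K] {s : Set E} (hs : IsOpen s) :
    IsOpen {φ : C(K, E) | ∀ κ, φ κ ∈ s} := by
  simpa [MapsTo] using ContinuousMap.isOpen_setOfPred_mapsTo (isCompact_univ (X := K)) hs

end CompOp

variable {K : Type*} [TopologicalSpace K] [CompactSpace K]
  {E F : Type*} [NormedAddCommGroup E] [NormedSpace ℂ E]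
  [NormedAddCommGroup F] [NormedSpace ℂ F]

variable (K E F) in
/-- Pointwise evaluation of a continuous family of operators on a continuous family of vectors. -/
noncomputable def pointwiseApplyL : C(K, E →L[ℂ] F) →L[ℂ] C(K, E) →L[ℂ] C(K, F) :=
  LinearMap.mkContinuous₂
    (LinearMap.mk₂ ℂ (fun (A : C(K, E →L[ℂ] F)) (h : C(K, E)) =>
        (⟨fun κ => A κ (h κ), by fun_prop⟩ : C(K, F)))
      (by intros; ext; simp) (by intros; ext; simp) (by intros; ext; simp)
      (by intros; ext; simp)) 1 (by
    intro A h
    rw [ContinuousMap.norm_le _ (by positivity)]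
    intro κ
    rw [one_mul]
    exact ((A κ).le_opNorm _).trans
      (mul_le_mul (A.norm_coe_le_norm κ) (h.norm_coe_le_norm κ) (norm_nonneg _) (norm_nonneg A)))

@[simp] theorem pointwiseApplyL_apply (A : C(K, E →L[ℂ] F)) (h : C(K, E)) (κ : K) :
    pointwiseApplyL K E F A h κ = A κ (h κ) := rfl

theorem norm_pointwiseApplyL_le (A : C(K, E →L[ℂ] F)) (h : C(K, E)) :
    ‖pointwiseApplyL K E F A h‖ ≤ ‖A‖ * ‖h‖ := by
  rw [ContinuousMap.norm_le _ (by positivity)]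
  intro κ
  exact ((A κ).le_opNorm _).trans
    (mul_le_mul (A.norm_coe_le_norm κ) (h.norm_coe_le_norm κ) (norm_nonneg _) (norm_nonneg A))

/-- Compactness of the range of φ gives a single radius δ such that f varies by at most 1 on the
δ-ball about each φ(κ). The second order Taylor estimate then has the constant 2/δ² for all κ, so
the pointwise remainders are quadratic in the sup norm. -/
theorem hasFDerivAt_compOp {f : E → F} {s : Set E} (hs : IsOpen s) (hf : DifferentiableOn ℂ f s)
    {φ : C(K, E)} (hφ : ∀ κ, φ κ ∈ s) :
    HasFDerivAt (compOp f) (pointwiseApplyL K E F (compOp (fderiv ℂ f) φ)) φ := by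
  have hcomp : IsCompact (range φ) := isCompact_range φ.continuous
  have hsub : range φ ⊆ s := range_subset_iff.2 hφ
  obtain ⟨δ₁, hδ₁, hthick⟩ := hcomp.exists_thickening_subset_open hs hsub
  have hunif := hcomp.uniformContinuousAt_of_continuousAt f
    (fun x hx => (hf.continuousOn.continuousAt (hs.mem_nhds (hsub hx))))
    (Metric.dist_mem_uniformity one_pos)
  obtain ⟨δ₂, hδ₂, hunif⟩ := Metric.mem_uniformity_dist.1 hunif
  set δ := min δ₁ δ₂
  have hδ : 0 < δ := lt_min hδ₁ hδ₂
  have hb : ∀ κ, ball (φ κ) δ ⊆ s := fun κ =>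
    ((ball_subset_ball (min_le_left _ _)).trans (ball_subset_thickening (mem_range_self κ) _)).trans
      hthick
  have hm : ∀ κ, MapsTo f (ball (φ κ) δ) (closedBall (f (φ κ)) 1) := by
    intro κ y hy
    have : dist (φ κ) y < δ₂ := by
      rw [dist_comm]; exact lt_of_lt_of_le (mem_ball.1 hy) (min_le_right _ _)
    have := hunif this (mem_range_self κ)
    rw [mem_closedBall, dist_comm]
    exact le_of_lt this
  refine HasFDerivAt.of_isLittleO ?_
  have hO : (fun ψ => compOp f ψ - compOp f φ -
      pointwiseApplyL K E F (compOp (fderiv ℂ f) φ) (ψ - φ)) =O[𝓝 φ] fun ψ => ‖ψ - φ‖ ^ 2 := by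
    refine Asymptotics.IsBigO.of_bound (2 / δ ^ 2) ?_
    filter_upwards [ball_mem_nhds φ hδ] with ψ hψ
    have hψκ : ∀ κ, ψ κ ∈ ball (φ κ) δ := fun κ =>
      (ContinuousMap.dist_apply_le_dist κ).trans_lt hψ
    rw [ContinuousMap.norm_le _ (by positivity)]
    intro κ
    simp only [coe_sub, Pi.sub_apply, pointwiseApplyL_apply]
    rw [compOp_apply hf.continuousOn (fun κ => hb κ (hψκ κ)), compOp_apply hf.continuousOn hφ,
      compOp_apply (hf.continuousOn_fderiv_complex hs) hφ]
    refine ((hf.mono (hb κ)).norm_sub_fderiv_le (hm κ) (hψκ κ)).trans ?_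
    have : ‖ψ κ - φ κ‖ ≤ ‖ψ - φ‖ := (ψ - φ).norm_coe_le_norm κ
    rw [norm_pow, norm_norm, div_pow]
    calc 2 * 1 * (‖ψ κ - φ κ‖ ^ 2 / δ ^ 2) ≤ 2 * 1 * (‖ψ - φ‖ ^ 2 / δ ^ 2) := by gcongr
      _ = _ := by ring
  refine hO.trans_isLittleO ?_
  have : Tendsto (fun ψ => ψ - φ) (𝓝 φ) (𝓝 0) := by
    have : Continuous fun ψ : C(K, E) => ψ - φ := by fun_prop
    simpa using this.tendsto φ
  exact (Asymptotics.isLittleO_norm_pow_id (E' := C(K, E)) one_lt_two).comp_tendsto this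

theorem differentiableOn_compOp {G : Type*} [NormedAddCommGroup G] [NormedSpace ℂ G]
    {f : E → F} {s : Set E} (hs : IsOpen s) (hf : DifferentiableOn ℂ f s)
    {A : G → C(K, E)} {t : Set G} (hA : DifferentiableOn ℂ A t) (h : ∀ x ∈ t, ∀ κ, A x κ ∈ s) :
    DifferentiableOn ℂ (fun x => compOp f (A x)) t := fun x hx =>
  (hasFDerivAt_compOp hs hf (h x hx)).differentiableAt.comp_differentiableWithinAt x (hA x hx)

/-- The indefinite integral on the unit interval as a continuous linear map. -/
noncomputable def volterraL (E : Type*) [NormedAddCommGroup E] [NormedSpace ℂ E] :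
    C(Icc (0 : ℝ) 1, E) →L[ℂ] C(Icc (0 : ℝ) 1, E) :=
  LinearMap.mkContinuous
    { toFun := fun φ => ⟨fun s => ∫ τ in (0 : ℝ)..s, Set.IccExtend zero_le_one φ τ,
        (intervalIntegral.continuous_primitive (fun a b =>
          (φ.continuous.Icc_extend' (h := zero_le_one)).intervalIntegrable a b) 0).comp
          continuous_subtype_val⟩
      map_add' := by
        intro φ ψ
        ext s
        exact intervalIntegral.integral_add
          ((φ.continuous.Icc_extend' (h := zero_le_one)).intervalIntegrable 0 s)
          ((ψ.continuous.Icc_extend' (h := zero_le_one)).intervalIntegrable 0 s)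
      map_smul' := by
        intro c φ
        ext s
        exact intervalIntegral.integral_smul c _ } 1 (by
    intro φ
    rw [ContinuousMap.norm_le _ (by positivity)]
    intro s
    have := intervalIntegral.norm_integral_le_of_norm_le_const (a := 0) (b := (s : ℝ))
      (f := Set.IccExtend zero_le_one φ) (C := ‖φ‖) (fun τ _ => φ.norm_coe_le_norm _)
    refine this.trans ?_
    rw [sub_zero, abs_of_nonneg s.2.1, one_mul]
    exact mul_le_of_le_one_right (norm_nonneg _) s.2.2)

theorem volterraL_apply (φ : C(Icc (0 : ℝ) 1, E)) (s : Icc (0 : ℝ) 1) :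
    volterraL E φ s = ∫ τ in (0 : ℝ)..s, Set.IccExtend zero_le_one φ τ := rfl

theorem norm_volterraL_le (φ : C(Icc (0 : ℝ) 1, E)) : ‖volterraL E φ‖ ≤ ‖φ‖ := by
  have := (volterraL E).le_of_opNorm_le (LinearMap.mkContinuous_norm_le _ zero_le_one _) φ
  simpa using this

end ContinuousMap

namespace ContinuousMap

/-- Constant functions, as a continuous linear map. -/
noncomputable def constCLM (K E : Type*) [TopologicalSpace K] [CompactSpace K]
    [NormedAddCommGroup E] [NormedSpace ℂ E] : E →L[ℂ] C(K, E) :=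
  LinearMap.mkContinuous
    { toFun := fun x => ContinuousMap.const K x
      map_add' := fun _ _ => rfl
      map_smul' := fun _ _ => rfl } 1 (by
    intro x
    rw [ContinuousMap.norm_le _ (by positivity)]
    intro κ
    exact (one_mul ‖x‖).ge)

@[simp] theorem constCLM_apply {K E : Type*} [TopologicalSpace K] [CompactSpace K]
    [NormedAddCommGroup E] [NormedSpace ℂ E] (x : E) (κ : K) : constCLM K E x κ = x := rfl

end ContinuousMap

/-! ### Osgood's lemma: holomorphic maps in finite dimension are analytic. -/

section Osgood

open ContinuousMap

variable {E F : Type*} [NormedAddCommGroup E] [NormedSpace ℂ E]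
  [NormedAddCommGroup F] [NormedSpace ℂ F] [CompleteSpace F]

/-- Cauchy's formula, written as an integral over the unit interval. -/
theorem DiffContOnCl.integral_unit_interval_eq {f : ℂ → F} {c w : ℂ} {R : ℝ}
    (hf : DiffContOnCl ℂ f (ball c R)) (hw : w ∈ ball c R) :
    ∫ τ in (0 : ℝ)..1, (circleMap 0 R (2 * Real.pi * τ) *
      (circleMap c R (2 * Real.pi * τ) - w)⁻¹) • f (circleMap c R (2 * Real.pi * τ)) = f w := by
  have h := hf.two_pi_i_inv_smul_circleIntegral_sub_inv_smul hw
  rw [circleIntegral] at h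
  have h2 := intervalIntegral.integral_comp_mul_left (a := 0) (b := 1) (c := 2 * Real.pi)
    (fun θ => (circleMap 0 R θ * (circleMap c R θ - w)⁻¹) • f (circleMap c R θ))
    (by positivity)
  rw [h2, ← h]
  simp only [mul_zero, mul_one, deriv_circleMap]
  have h3 : ∀ θ : ℝ, (circleMap 0 R θ * Complex.I) • (circleMap c R θ - w)⁻¹ • f (circleMap c R θ)
      = Complex.I • ((circleMap 0 R θ * (circleMap c R θ - w)⁻¹) • f (circleMap c R θ)) := by
    intro θ
    simp only [smul_smul]
    congr 1
    ring
  simp only [h3]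
  rw [intervalIntegral.integral_smul, smul_smul]
  have h4 : (2 * (Real.pi : ℂ) * Complex.I)⁻¹ * Complex.I = (((2 * Real.pi)⁻¹ : ℝ) : ℂ) := by
    have : (Real.pi : ℂ) ≠ 0 := by exact_mod_cast Real.pi_ne_zero
    push_cast
    field_simp
  rw [h4, Complex.coe_smul]

/-- The inductive step of Osgood's lemma. -/
theorem analyticOnNhd_prod_of_differentiableOn
    (ih : ∀ (g : E → C(Icc (0 : ℝ) 1, F)) (t : Set E), IsOpen t → DifferentiableOn ℂ g t →
      AnalyticOnNhd ℂ g t)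
    {f : ℂ × E → F} {s : Set (ℂ × E)} (hs : IsOpen s) (hf : DifferentiableOn ℂ f s) :
    AnalyticOnNhd ℂ f s := by
  rintro ⟨z₀, x₀⟩ hp
  obtain ⟨R, hR, hball⟩ := Metric.nhds_basis_closedBall.mem_iff.1 (hs.mem_nhds hp)
  have hmem : ∀ z ∈ closedBall z₀ R, ∀ x ∈ ball x₀ R, (z, x) ∈ s := fun z hz x hx =>
    hball (by
      rw [mem_closedBall, Prod.dist_eq]
      exact max_le hz (mem_ball.1 hx).le)
  let γ : C(Icc (0 : ℝ) 1, ℂ × E) := ⟨fun κ => (circleMap z₀ R (2 * Real.pi * κ), 0), by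
    have := continuous_circleMap z₀ R
    fun_prop⟩
  let A : E → C(Icc (0 : ℝ) 1, ℂ × E) := fun x =>
    γ + (constCLM (Icc (0 : ℝ) 1) (ℂ × E) ∘L ContinuousLinearMap.inr ℂ ℂ E) x
  have hA : Differentiable ℂ A := by fun_prop
  -- `N x` records the values of f(·, x) on the circle about z₀. It is a holomorphic map in fewer
  -- variables with values in a Banach space, so the induction has to run over all targets at once.
  let N : E → C(Icc (0 : ℝ) 1, F) := fun x => compOp f (A x)
  have hNmem : ∀ x ∈ ball x₀ R, ∀ κ, A x κ ∈ s := by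
    intro x hx κ
    simpa [A, γ] using hmem _ (circleMap_mem_closedBall z₀ hR.le _) x hx
  have hN : AnalyticAt ℂ N x₀ := by
    refine ih N (ball x₀ R) isOpen_ball ?_ x₀ (mem_ball_self hR)
    refine differentiableOn_compOp hs hf hA.differentiableOn hNmem
  let δ : C(Icc (0 : ℝ) 1, ℂ × ℂ) :=
    ⟨fun κ => (circleMap 0 R (2 * Real.pi * κ), circleMap z₀ R (2 * Real.pi * κ)), by
      have := continuous_circleMap z₀ R
      have := continuous_circleMap 0 R
      fun_prop⟩
  let m : ℂ × ℂ → F →L[ℂ] F := fun q => (q.1 * q.2⁻¹) • ContinuousLinearMap.id ℂ F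
  have hmo : IsOpen {q : ℂ × ℂ | q.2 ≠ 0} := isOpen_ne_fun continuous_snd continuous_const
  have hm : DifferentiableOn ℂ m {q : ℂ × ℂ | q.2 ≠ 0} := by
    intro q hq
    have : q.2 ≠ 0 := hq
    apply DifferentiableAt.differentiableWithinAt
    apply DifferentiableAt.smul_const
    exact differentiableAt_fst.mul (differentiableAt_snd.inv this)
  let B : ℂ → C(Icc (0 : ℝ) 1, ℂ × ℂ) := fun z =>
    δ - (constCLM (Icc (0 : ℝ) 1) (ℂ × ℂ) ∘L ContinuousLinearMap.inr ℂ ℂ ℂ) z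
  have hB : Differentiable ℂ B := by fun_prop
  -- The Cauchy kernel, as a function of z alone. Cauchy's formula makes f(z, x) a continuous
  -- bilinear expression in `k z` and `N x`, hence jointly analytic.
  let k : ℂ → C(Icc (0 : ℝ) 1, F →L[ℂ] F) := fun z => compOp m (B z)
  have hkmem : ∀ z ∈ ball z₀ R, ∀ κ, B z κ ∈ {q : ℂ × ℂ | q.2 ≠ 0} := by
    intro z hz κ
    simpa [B, δ, sub_ne_zero] using circleMap_ne_mem_ball hz _
  have hk : AnalyticAt ℂ k z₀ := by
    have : DifferentiableOn ℂ k (ball z₀ R) :=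
      differentiableOn_compOp hmo hm hB.differentiableOn hkmem
    exact this.analyticAt (ball_mem_nhds _ hR)
  let ev : C(Icc (0 : ℝ) 1, F) →L[ℂ] F := ContinuousMap.evalCLM ℂ (1 : Icc (0 : ℝ) 1)
  have hk' : AnalyticAt ℂ (fun q : ℂ × E => k q.1) (z₀, x₀) :=
    AnalyticAt.fun_comp (f := Prod.fst) hk analyticAt_fst
  have hN' : AnalyticAt ℂ (fun q : ℂ × E => N q.2) (z₀, x₀) :=
    AnalyticAt.fun_comp (f := Prod.snd) hN analyticAt_snd
  have hkey : AnalyticAt ℂ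
      (fun q : ℂ × E => ev (volterraL F (pointwiseApplyL _ F F (k q.1) (N q.2)))) (z₀, x₀) := by
    refine ((ev ∘L volterraL F).analyticAt _).fun_comp ?_
    exact AnalyticAt.fun_comp (f := fun q : ℂ × E => (k q.1, N q.2))
      ((pointwiseApplyL (Icc (0 : ℝ) 1) F F).analyticAt_bilinear _) (hk'.prod hN')
  refine hkey.congr ?_
  filter_upwards [prod_mem_nhds (ball_mem_nhds z₀ hR) (ball_mem_nhds x₀ hR)]
  rintro ⟨z, x⟩ ⟨hz, hx⟩
  simp only [ev, ContinuousMap.evalCLM_apply, volterraL_apply]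
  have hfx : DiffContOnCl ℂ (fun ζ => f (ζ, x)) (ball z₀ R) := by
    apply DifferentiableOn.diffContOnCl
    rw [closure_ball _ hR.ne']
    exact hf.comp (by fun_prop) fun ζ hζ => hmem ζ hζ x hx
  rw [← hfx.integral_unit_interval_eq hz]
  have e1 : ((1 : Icc (0 : ℝ) 1) : ℝ) = 1 := rfl
  rw [e1]
  refine intervalIntegral.integral_congr fun τ hτ => ?_
  rw [uIcc_of_le zero_le_one] at hτ
  rw [IccExtend_of_mem _ _ hτ, pointwiseApplyL_apply,
    compOp_apply hm.continuousOn (hkmem z hz), compOp_apply hf.continuousOn (hNmem x hx)]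
  simp [m, A, B, δ, γ]

/-- **Osgood's lemma** on `ℂᵐ`. -/
theorem analyticOnNhd_pi_of_differentiableOn (m : ℕ) : ∀ {F : Type*} [NormedAddCommGroup F]
    [NormedSpace ℂ F] [CompleteSpace F] {f : (Fin m → ℂ) → F} {s : Set (Fin m → ℂ)},
    IsOpen s → DifferentiableOn ℂ f s → AnalyticOnNhd ℂ f s := by
  induction m with
  | zero =>
    intro F _ _ _ f s _ _ x _
    have : f = fun _ => f x := funext fun y => congrArg f (Subsingleton.elim y x)
    rw [this]
    exact analyticAt_const
  | succ m ih =>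
    intro F _ _ _ f s hs hf
    let T : (ℂ × (Fin m → ℂ)) ≃L[ℂ] (Fin (m + 1) → ℂ) :=
      (Fin.consLinearEquiv ℂ fun _ : Fin (m + 1) => ℂ).toContinuousLinearEquiv
    have h := analyticOnNhd_prod_of_differentiableOn (fun g t ht hg => ih ht hg)
      (f := f ∘ T) (s := T ⁻¹' s) (hs.preimage T.continuous)
      (hf.comp T.differentiable.differentiableOn fun _ h => h)
    have h2 := h.comp (T.symm.analyticOnNhd s) (fun x hx => by simpa using hx)
    have e : (f ∘ T) ∘ T.symm = f := by ext x; simp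
    rwa [e] at h2

/-- **Osgood's lemma**: a complex differentiable function on an open subset of a finite
dimensional complex space is analytic. -/
theorem DifferentiableOn.analyticOnNhd_complex [FiniteDimensional ℂ E] {f : E → F} {s : Set E}
    (hs : IsOpen s) (hf : DifferentiableOn ℂ f s) : AnalyticOnNhd ℂ f s := by
  let T : E ≃L[ℂ] (Fin (Module.finrank ℂ E) → ℂ) :=
    ContinuousLinearEquiv.ofFinrankEq (by simp)
  have h := analyticOnNhd_pi_of_differentiableOn _ (f := f ∘ T.symm) (s := T.symm ⁻¹' s)
    (hs.preimage T.symm.continuous)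
    (hf.comp T.symm.differentiable.differentiableOn fun _ h => h)
  have h2 := h.comp (T.analyticOnNhd s) (fun x hx => by simpa using hx)
  have e : (f ∘ T.symm) ∘ T = f := by ext x; simp
  rwa [e] at h2

end Osgood

/-! ### Holomorphic joint flow of commuting vector fields. -/

section Flow

open ContinuousMap

variable {E W : Type*} [NormedAddCommGroup E] [NormedSpace ℂ E]
  [NormedAddCommGroup W] [NormedSpace ℂ W]

/-- The right hand side `x + ∫₀ X(φ) w` of the integral equation for the flow of the vector
fields `X · w`, as a function of `((x, w), φ)`. -/
noncomputable def picardOp (X : E → W →L[ℂ] E) (u : (E × W) × C(Icc (0 : ℝ) 1, E)) :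
    C(Icc (0 : ℝ) 1, E) :=
  constCLM _ E u.1.1 +
    volterraL E (pointwiseApplyL _ W E (compOp X u.2) (constCLM _ W u.1.2))

/-- The derivative of `picardOp`. -/
noncomputable def picardOpDeriv (X : E → W →L[ℂ] E) (u a : (E × W) × C(Icc (0 : ℝ) 1, E)) :
    C(Icc (0 : ℝ) 1, E) :=
  constCLM _ E a.1.1 + volterraL E
    (pointwiseApplyL _ W E (compOp X u.2) (constCLM _ W a.1.2) +
      pointwiseApplyL _ W E (pointwiseApplyL _ E (W →L[ℂ] E) (compOp (fderiv ℂ X) u.2) a.2)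
        (constCLM _ W u.1.2))

/-- The chain and product rules produce the continuous linear map; only its values, the bare
function `picardOpDeriv`, are needed for computations. -/
theorem exists_hasFDerivAt_picardOp {X : E → W →L[ℂ] E} {s : Set E} (hs : IsOpen s)
    (hX : DifferentiableOn ℂ X s) {u : (E × W) × C(Icc (0 : ℝ) 1, E)} (hu : ∀ κ, u.2 κ ∈ s) :
    ∃ L : (E × W) × C(Icc (0 : ℝ) 1, E) →L[ℂ] C(Icc (0 : ℝ) 1, E),
      HasFDerivAt (picardOp X) L u ∧ ∀ a, L a = picardOpDeriv X u a := by
  have h1 : HasFDerivAt (fun u : (E × W) × C(Icc (0 : ℝ) 1, E) => compOp X u.2) _ u :=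
    (hasFDerivAt_compOp hs hX hu).comp u hasFDerivAt_snd
  have h2 : HasFDerivAt (fun u : (E × W) × C(Icc (0 : ℝ) 1, E) => constCLM (Icc (0 : ℝ) 1) W u.1.2)
      _ u := (constCLM (Icc (0 : ℝ) 1) W).hasFDerivAt.comp u
        ((hasFDerivAt_snd (𝕜 := ℂ) (p := u.1)).comp u hasFDerivAt_fst)
  have h3 : HasFDerivAt (fun u : (E × W) × C(Icc (0 : ℝ) 1, E) => constCLM (Icc (0 : ℝ) 1) E u.1.1)
      _ u := (constCLM (Icc (0 : ℝ) 1) E).hasFDerivAt.comp u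
        ((hasFDerivAt_fst (𝕜 := ℂ) (p := u.1)).comp u hasFDerivAt_fst)
  have h4 := (pointwiseApplyL (Icc (0 : ℝ) 1) W E).hasFDerivAt_of_bilinear h1 h2
  refine ⟨_, h3.add ((volterraL E).hasFDerivAt.comp u h4), fun a => ?_⟩
  simp only [picardOpDeriv]
  rfl

/-- A solution `φ` of `φ' = X(φ) w` on the unit interval. -/
theorem hasDerivAt_of_eq_picardOp [CompleteSpace E] {X : E → W →L[ℂ] E} {s : Set E} (hX : ContinuousOn X s)
    {x : E} {w : W} {φ : C(Icc (0 : ℝ) 1, E)} (hφ : ∀ κ, φ κ ∈ s) (h : φ = picardOp X ((x, w), φ))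
    {τ : ℝ} (hτ : τ ∈ Ioo (0 : ℝ) 1) :
    HasDerivAt (Set.IccExtend zero_le_one φ) (X (Set.IccExtend zero_le_one φ τ) w) τ := by
  have hc : Continuous (Set.IccExtend zero_le_one φ) := φ.continuous.Icc_extend'
  have hcX : Continuous fun σ => X (Set.IccExtend zero_le_one φ σ) w :=
    (hX.comp_continuous hc fun σ => hφ _).clm_apply continuous_const
  have h1 : HasDerivAt (fun σ => x + ∫ ν in (0 : ℝ)..σ, X (Set.IccExtend zero_le_one φ ν) w)
      (X (Set.IccExtend zero_le_one φ τ) w) τ :=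
    (intervalIntegral.integral_hasDerivAt_right (hcX.intervalIntegrable _ _)
      (hcX.stronglyMeasurableAtFilter _ _) hcX.continuousAt).const_add x
  refine h1.congr_of_eventuallyEq ?_
  filter_upwards [Ioo_mem_nhds hτ.1 hτ.2] with σ hσ
  have hσ' : σ ∈ Icc (0 : ℝ) 1 := ⟨hσ.1.le, hσ.2.le⟩
  have hσφ := DFunLike.congr_fun h ⟨σ, hσ'⟩
  rw [Set.IccExtend_of_mem _ _ hσ', hσφ, picardOp]
  simp only [ContinuousMap.add_apply, constCLM_apply, volterraL_apply]
  congr 1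
  refine intervalIntegral.integral_congr fun ν _ => ?_
  simp only [Set.IccExtend, Function.comp_apply, pointwiseApplyL_apply, constCLM_apply]
  rw [compOp_apply hX hφ]

/-- For commuting fields, `κ ↦ κ X(φ(κ)) v` solves the linearized equation. -/
theorem smul_eq_picardOpDeriv [CompleteSpace E] {X : E → W →L[ℂ] E} {s : Set E} (hs : IsOpen s)
    (hX : DifferentiableOn ℂ X s)
    (hcomm : ∀ x ∈ s, ∀ v w, fderiv ℂ X x (X x v) w = fderiv ℂ X x (X x w) v)
    {x : E} {w : W} {φ : C(Icc (0 : ℝ) 1, E)} (hφ : ∀ κ, φ κ ∈ s)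
    (h : φ = picardOp X ((x, w), φ)) (v : W) {B : C(Icc (0 : ℝ) 1, E)}
    (hB : ∀ κ, B κ = (κ : ℝ) • X (φ κ) v) :
    B = picardOpDeriv X ((x, w), φ) ((0, v), B) := by
  have hc : Continuous (Set.IccExtend zero_le_one φ) := φ.continuous.Icc_extend'
  have hmem : ∀ σ, Set.IccExtend zero_le_one φ σ ∈ s := fun σ => hφ _
  have hcX : Continuous fun σ => X (Set.IccExtend zero_le_one φ σ) :=
    hX.continuousOn.comp_continuous hc hmem
  have hcX' : Continuous fun σ => fderiv ℂ X (Set.IccExtend zero_le_one φ σ) :=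
    (hX.continuousOn_fderiv_complex hs).comp_continuous hc hmem
  set φe := Set.IccExtend zero_le_one φ with hφe
  -- The product rule gives X(φ)v + τ DX(φ)(X(φ)w)v. Commutation exchanges v and w in the last term,
  -- which turns it into the integrand of the linearized equation.
  set g' : ℝ → E := fun τ => X (φe τ) v + fderiv ℂ X (φe τ) (τ • X (φe τ) v) w with hg'
  have hg'c : Continuous g' :=
    (hcX.clm_apply continuous_const).add ((hcX'.clm_apply
      (continuous_id.smul (hcX.clm_apply continuous_const))).clm_apply continuous_const)
  have hder : ∀ τ ∈ Ioo (0 : ℝ) 1, HasDerivAt (fun τ : ℝ => τ • X (φe τ) v) (g' τ) τ := by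
    intro τ hτ
    have h1 : HasDerivAt φe (X (φe τ) w) τ := hasDerivAt_of_eq_picardOp hX.continuousOn hφ h hτ
    have h2 : HasFDerivAt X (fderiv ℂ X (φe τ)) (φe τ) :=
      (hX.differentiableAt (hs.mem_nhds (hmem τ))).hasFDerivAt
    have h3 : HasDerivAt (fun σ => X (φe σ)) (fderiv ℂ X (φe τ) (X (φe τ) w)) τ :=
      (h2.restrictScalars ℝ).comp_hasDerivAt τ h1
    have h4 : HasDerivAt (fun σ => X (φe σ) v) (fderiv ℂ X (φe τ) (X (φe τ) w) v) τ :=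
      (((ContinuousLinearMap.apply ℂ E v).restrictScalars ℝ).hasFDerivAt).comp_hasDerivAt τ h3
    have h5 := (hasDerivAt_id τ).smul h4
    refine h5.congr_deriv ?_
    simp only [hg', id, one_smul]
    rw [hcomm _ (hmem τ) w v, add_comm]
    congr 1
    exact Eq.symm <| congrArg (fun L : W →L[ℂ] E => L w)
      (((fderiv ℂ X (φe τ)).restrictScalars ℝ).map_smul τ (X (φe τ) v))
  ext κ
  simp only [picardOpDeriv, map_zero, zero_add, volterraL_apply]
  have hint := intervalIntegral.integral_eq_sub_of_hasDerivAt_of_le κ.2.1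
    (f := fun τ : ℝ => τ • X (φe τ) v) (f' := g')
    (continuous_id.smul (hcX.clm_apply continuous_const)).continuousOn
    (fun τ hτ => hder τ ⟨hτ.1, hτ.2.trans_le κ.2.2⟩)
    (hg'c.intervalIntegrable _ _)
  have hκ : φe κ = φ κ := by simp [hφe]
  rw [zero_smul, sub_zero, hκ, ← hB] at hint
  rw [← hint]
  refine intervalIntegral.integral_congr fun τ hτ => ?_
  rw [uIcc_of_le κ.2.1] at hτ
  have hτ' : τ ∈ Icc (0 : ℝ) 1 := ⟨hτ.1, hτ.2.trans κ.2.2⟩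
  simp only [Set.IccExtend_of_mem _ _ hτ', ContinuousMap.add_apply, pointwiseApplyL_apply,
    constCLM_apply, hg', hφe]
  rw [compOp_apply hX.continuousOn hφ, compOp_apply (hX.continuousOn_fderiv_complex hs) hφ, hB]

/-- Uniqueness for the linearized equation. -/
theorem eq_of_eq_picardOpDeriv {X : E → W →L[ℂ] E} {s : Set E} (hs : IsOpen s)
    (hX : DifferentiableOn ℂ X s) {C : ℝ} (hC : 0 ≤ C) (hXC : ∀ x ∈ s, ‖fderiv ℂ X x‖ ≤ C)
    {q : E × W} (hq : C * ‖q.2‖ < 1) {φ : C(Icc (0 : ℝ) 1, E)} (hφ : ∀ κ, φ κ ∈ s) {a : E × W}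
    {A B : C(Icc (0 : ℝ) 1, E)} (hA : A = picardOpDeriv X (q, φ) (a, A))
    (hB : B = picardOpDeriv X (q, φ) (a, B)) : A = B := by
  -- The difference solves the homogeneous equation, whose right hand side contracts by the factor
  -- C‖w‖ < 1; smallness of w replaces a Gronwall argument.
  have hD : A - B = volterraL E (pointwiseApplyL _ W E
      (pointwiseApplyL _ E (W →L[ℂ] E) (compOp (fderiv ℂ X) φ) (A - B)) (constCLM _ W q.2)) := by
    nth_rewrite 1 [hA, hB]
    simp only [picardOpDeriv, map_sub, map_add, _root_.sub_apply]
    abel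
  have hn : ‖compOp (fderiv ℂ X) φ‖ ≤ C := by
    rw [ContinuousMap.norm_le _ hC]
    intro κ
    rw [compOp_apply (hX.continuousOn_fderiv_complex hs) hφ]
    exact hXC _ (hφ κ)
  have hw : ‖constCLM (Icc (0 : ℝ) 1) W q.2‖ ≤ ‖q.2‖ := by
    rw [ContinuousMap.norm_le _ (norm_nonneg _)]
    intro κ
    exact le_rfl
  have hle : ‖A - B‖ ≤ C * ‖q.2‖ * ‖A - B‖ := by
    nth_rewrite 1 [hD]
    refine (norm_volterraL_le _).trans ((norm_pointwiseApplyL_le _ _).trans ?_)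
    calc _ ≤ (C * ‖A - B‖) * ‖q.2‖ := by
          refine mul_le_mul ((norm_pointwiseApplyL_le _ _).trans ?_) hw (norm_nonneg _)
            (by positivity)
          exact mul_le_mul_of_nonneg_right hn (norm_nonneg _)
      _ = _ := by ring
  rw [← sub_eq_zero, ← norm_eq_zero]
  by_contra hne
  have hpos : 0 < ‖A - B‖ := lt_of_le_of_ne (norm_nonneg _) (Ne.symm hne)
  nlinarith

/-- The joint flow `Ψ(x, w)` at time one of the fields `X · w`, for commuting holomorphic vector
fields `X · v` on an open set. -/
theorem exists_flow_of_commute [CompleteSpace E] [CompleteSpace W] {X : E → W →L[ℂ] E} {s : Set E} (hs : IsOpen s)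
    (hX : DifferentiableOn ℂ X s)
    (hcomm : ∀ x ∈ s, ∀ v w, fderiv ℂ X x (X x v) w = fderiv ℂ X x (X x w) v)
    {x₀ : E} (hx₀ : x₀ ∈ s) :
    ∃ Ψ : E × W → E, Ψ (x₀, 0) = x₀ ∧
      (∀ᶠ q in 𝓝 ((x₀, 0) : E × W), Ψ q ∈ s ∧ DifferentiableAt ℂ Ψ q ∧
        ∀ v, fderiv ℂ Ψ q (0, v) = X (Ψ q) v) ∧
      ∀ a v, fderiv ℂ Ψ (x₀, 0) (a, v) = a + X x₀ v := by
  obtain ⟨C, hC, t, hts, hto, hx₀t, htC⟩ : ∃ C : ℝ, 0 ≤ C ∧ ∃ t ⊆ s, IsOpen t ∧ x₀ ∈ t ∧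
      ∀ x ∈ t, ‖fderiv ℂ X x‖ ≤ C := by
    have hcont := ((hX.continuousOn_fderiv_complex hs).continuousAt (hs.mem_nhds hx₀)).norm
    have hev := (hcont.eventually (gt_mem_nhds (lt_add_one _))).and (hs.mem_nhds hx₀)
    obtain ⟨t, ht, hto, hxt⟩ := _root_.mem_nhds_iff.1 hev
    exact ⟨‖fderiv ℂ X x₀‖ + 1, by positivity, t, fun x hx => (ht hx).2, hto, hxt,
      fun x hx => (ht hx).1.le⟩
  replace hX := hX.mono hts
  replace hcomm : ∀ x ∈ t, ∀ v w, fderiv ℂ X x (X x v) w = fderiv ℂ X x (X x w) v :=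
    fun x hx => hcomm x (hts hx)
  let u₀ : (E × W) × C(Icc (0 : ℝ) 1, E) := ((x₀, 0), constCLM _ E x₀)
  -- Zeros of G are the solution curves. For w = 0 the integral vanishes identically, so the
  -- φ-derivative at the constant curve x₀ is the identity and the implicit function theorem
  -- applies.
  let G : (E × W) × C(Icc (0 : ℝ) 1, E) → C(Icc (0 : ℝ) 1, E) := fun u => u.2 - picardOp X u
  let Ω : Set ((E × W) × C(Icc (0 : ℝ) 1, E)) := {u | ∀ κ, u.2 κ ∈ t}
  have hΩ : IsOpen Ω := (isOpen_setOf_forall_mem hto).preimage continuous_snd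
  have hu₀ : u₀ ∈ Ω := fun κ => hx₀t
  have hGd : ∀ u ∈ Ω, ∃ L : (E × W) × C(Icc (0 : ℝ) 1, E) →L[ℂ] C(Icc (0 : ℝ) 1, E),
      HasFDerivAt G L u ∧ ∀ a, L a = a.2 - picardOpDeriv X u a := by
    intro u hu
    obtain ⟨L, hL, hLa⟩ := exists_hasFDerivAt_picardOp hto hX hu
    exact ⟨_, hasFDerivAt_snd.sub hL, fun a => by simp [hLa]⟩
  have hG : ContDiffAt ℂ 1 G u₀ := by
    have : DifferentiableOn ℂ G Ω := fun u hu => by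
      obtain ⟨L, hL, -⟩ := hGd u hu
      exact hL.differentiableAt.differentiableWithinAt
    exact (this.contDiffOn_one_complex hΩ).contDiffAt (hΩ.mem_nhds hu₀)
  have hGu₀ : G u₀ = 0 := by
    simp [G, u₀, picardOp]
  have hinv : (fderiv ℂ G u₀ ∘L .inr ℂ (E × W) C(Icc (0 : ℝ) 1, E)).IsInvertible := by
    obtain ⟨L, hL, hLa⟩ := hGd u₀ hu₀
    have : fderiv ℂ G u₀ ∘L .inr ℂ (E × W) C(Icc (0 : ℝ) 1, E) =
        ContinuousLinearMap.id ℂ C(Icc (0 : ℝ) 1, E) := by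
      rw [hL.fderiv]
      refine ContinuousLinearMap.ext fun a => ?_
      simp [hLa, picardOpDeriv, u₀]
    rw [this]
    exact ⟨ContinuousLinearEquiv.refl ℂ _, rfl⟩
  let ψ : E × W → C(Icc (0 : ℝ) 1, E) := hG.implicitFunction one_ne_zero hinv
  have hψ₀ : ψ (x₀, 0) = constCLM _ E x₀ := hG.implicitFunction_apply_self one_ne_zero hinv
  have hψG : ∀ᶠ q in 𝓝 ((x₀, 0) : E × W), G (q, ψ q) = 0 := by
    have := hG.eventually_apply_implicitFunction one_ne_zero hinv
    rwa [hGu₀] at this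
  have hψc : ContDiffAt ℂ 1 ψ (x₀, 0) := hG.contDiffAt_implicitFunction one_ne_zero hinv
  have hψΩ : ∀ᶠ q in 𝓝 ((x₀, 0) : E × W), ∀ κ, ψ q κ ∈ t := by
    refine hψc.continuousAt.eventually ((isOpen_setOf_forall_mem hto).mem_nhds ?_)
    rw [hψ₀]
    exact fun κ => hx₀t
  have hψd : ∀ᶠ q in 𝓝 ((x₀, 0) : E × W), DifferentiableAt ℂ ψ q := by
    filter_upwards [hψc.eventually (by simp)] with q hq using hq.differentiableAt one_ne_zero
  have hsmall : ∀ᶠ q in 𝓝 ((x₀, 0) : E × W), C * ‖q.2‖ < 1 := by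
    have : ContinuousAt (fun q : E × W => C * ‖q.2‖) (x₀, 0) := by fun_prop
    exact this.eventually (gt_mem_nhds (by simp))
  have hlin : ∀ᶠ q in 𝓝 ((x₀, 0) : E × W), ∀ a,
      fderiv ℂ ψ q a = picardOpDeriv X (q, ψ q) (a, fderiv ℂ ψ q a) := by
    filter_upwards [hψG.eventually_nhds, hψΩ, hψd] with q hq hqt hqd a
    obtain ⟨L, hL, hLa⟩ := hGd (q, ψ q) hqt
    have h1 : HasFDerivAt (fun q' => G (q', ψ q'))
        (L ∘L (ContinuousLinearMap.id ℂ (E × W)).prod (fderiv ℂ ψ q)) q :=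
      hL.comp q ((hasFDerivAt_id q).prodMk hqd.hasFDerivAt)
    have h2 : HasFDerivAt (fun q' => G (q', ψ q')) (0 : E × W →L[ℂ] C(Icc (0 : ℝ) 1, E)) q :=
      (hasFDerivAt_const (0 : C(Icc (0 : ℝ) 1, E)) q).congr_of_eventuallyEq hq
    have h3 := congrArg (fun L : E × W →L[ℂ] C(Icc (0 : ℝ) 1, E) => L a) (h1.unique h2)
    simp only [ContinuousLinearMap.comp_apply, ContinuousLinearMap.prod_apply, hLa,
      ContinuousLinearMap.id_apply, _root_.zero_apply] at h3
    exact sub_eq_zero.1 h3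
  let ev : C(Icc (0 : ℝ) 1, E) →L[ℂ] E := ContinuousMap.evalCLM ℂ (1 : Icc (0 : ℝ) 1)
  have hΨ : ∀ q, DifferentiableAt ℂ ψ q →
      HasFDerivAt (fun q => ev (ψ q)) (ev ∘L fderiv ℂ ψ q) q := fun q hq =>
    ev.hasFDerivAt.comp q hq.hasFDerivAt
  refine ⟨fun q => ev (ψ q), ?_, ?_, ?_⟩
  · simp [hψ₀, ev]
  · filter_upwards [hψG, hψΩ, hψd, hsmall, hlin] with q hqG hqt hqd hqs hql
    refine ⟨hts (hqt 1), (hΨ q hqd).differentiableAt, fun v => ?_⟩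
    rw [(hΨ q hqd).fderiv]
    have hfix : ψ q = picardOp X ((q.1, q.2), ψ q) := sub_eq_zero.1 hqG
    -- The w-derivative of the solution curve and this explicit curve solve the same linearized
    -- equation, so they agree; evaluation at time 1 gives X(Ψ)v.
    let B : C(Icc (0 : ℝ) 1, E) := ⟨fun κ => (κ : ℝ) • X (ψ q κ) v, by
      have : Continuous fun κ => X (ψ q κ) := hX.continuousOn.comp_continuous (ψ q).continuous hqt
      exact (continuous_subtype_val).smul (this.clm_apply continuous_const)⟩
    have hB := smul_eq_picardOpDeriv hto hX hcomm hqt hfix v (B := B) fun κ => rfl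
    have := eq_of_eq_picardOpDeriv hto hX hC htC hqs hqt (hql (0, v)) hB
    rw [ContinuousLinearMap.comp_apply, this]
    simp [ev, B]
  · intro a v
    rw [(hΨ _ hψd.self_of_nhds).fderiv, ContinuousLinearMap.comp_apply, hlin.self_of_nhds (a, v)]
    simp only [picardOpDeriv, ev, ContinuousMap.evalCLM_apply, ContinuousMap.add_apply,
      constCLM_apply, volterraL_apply, hψ₀]
    congr 1
    trans ∫ τ in (0 : ℝ)..1, X x₀ v
    · refine intervalIntegral.integral_congr fun τ _ => ?_
      simp only [Set.IccExtend, Function.comp_apply, pointwiseApplyL_apply,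
        constCLM_apply, map_zero, add_zero]
      rw [compOp_apply hX.continuousOn fun κ => by simpa using hx₀t]
      simp
    · simp

end Flow

/-! ### Brackets of fields with constant image under a differential. -/

section Bracket

variable {E Q : Type*} [NormedAddCommGroup E] [NormedSpace ℝ E]
  [NormedAddCommGroup Q] [NormedSpace ℝ Q]

/-- If the differential of `Φ` maps two vector fields to constant ones, it kills their bracket. -/
theorem ContDiffAt.fderiv_bracket_eq_zero {Φ : E → Q} {A B : E → E} {A' B' : E →L[ℝ] E} {x : E}
    (hΦ : ContDiffAt ℝ 2 Φ x) (hA : HasFDerivAt A A' x) (hB : HasFDerivAt B B' x) {a b : Q}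
    (hΦA : ∀ᶠ y in 𝓝 x, fderiv ℝ Φ y (A y) = a) (hΦB : ∀ᶠ y in 𝓝 x, fderiv ℝ Φ y (B y) = b) :
    fderiv ℝ Φ x (B' (A x) - A' (B x)) = 0 := by
  have hd : DifferentiableAt ℝ (fderiv ℝ Φ) x :=
    (hΦ.fderiv_right (m := 1) (by norm_num)).differentiableAt one_ne_zero
  -- Differentiate the identity dΦ(C) = c along v. Applied to A along B and to B along A, the second
  -- derivatives cancel by symmetry.
  have key : ∀ {C : E → E} {C' : E →L[ℝ] E} {c : Q}, HasFDerivAt C C' x →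
      (∀ᶠ y in 𝓝 x, fderiv ℝ Φ y (C y) = c) → ∀ v,
      fderiv ℝ (fderiv ℝ Φ) x v (C x) + fderiv ℝ Φ x (C' v) = 0 := by
    intro C C' c hC hc v
    have h1 := hd.hasFDerivAt.clm_apply hC
    have h2 : HasFDerivAt (fun y => fderiv ℝ Φ y (C y)) (0 : E →L[ℝ] Q) x :=
      (hasFDerivAt_const c x).congr_of_eventuallyEq hc
    have h3 := congrArg (fun L : E →L[ℝ] Q => L v) (h1.unique h2)
    rw [add_comm]
    simpa using h3
  have h1 := key hA hΦA (B x)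
  have h2 := key hB hΦB (A x)
  have hsymm : fderiv ℝ (fderiv ℝ Φ) x (A x) (B x) = fderiv ℝ (fderiv ℝ Φ) x (B x) (A x) :=
    (hΦ.isSymmSndFDerivAt (by simp)).eq _ _
  rw [map_sub, sub_eq_zero]
  rw [hsymm] at h2
  exact add_left_cancel (h2.trans h1.symm)

end Bracket

namespace ComplexGradient

/-! ### Gradient systems in a chart and commutation of their fields. -/

section Local

variable {E : Type*} [NormedAddCommGroup E] [NormedSpace ℂ E]
  {V : Type*} [NormedAddCommGroup V] [NormedSpace ℝ V]

/-- The subspace spanned by the vectors `A v` and `i A v`. -/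
noncomputable def complexSpan (A : V →ₗ[ℝ] E) : Submodule ℝ E :=
  Submodule.span ℝ (range (fun v : V => A v) ∪ range (fun v : V => Complex.I • A v))

theorem mem_complexSpan {A : V →ₗ[ℝ] E} {x : E} :
    x ∈ complexSpan A ↔ ∃ a b, A a + Complex.I • A b = x := by
  have h : complexSpan A =
      LinearMap.range A ⊔ LinearMap.range (((Complex.I • (LinearMap.id : E →ₗ[ℂ] E)).restrictScalars ℝ).comp A) := by
    rw [complexSpan, Submodule.span_union]
    congr 1
    · exact Submodule.span_eq (LinearMap.range A)
    · exact Submodule.span_eq (LinearMap.range (((Complex.I • (LinearMap.id : E →ₗ[ℂ] E)).restrictScalars ℝ).comp A))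
  rw [h, Submodule.mem_sup]
  constructor
  · rintro ⟨_, ⟨a, rfl⟩, _, ⟨b, rfl⟩, rfl⟩
    exact ⟨a, b, rfl⟩
  · rintro ⟨a, b, rfl⟩
    exact ⟨_, ⟨a, rfl⟩, _, ⟨b, rfl⟩, rfl⟩

/-- A gradient system in a holomorphic chart: holomorphic vector fields `X v` on the open set `s`,
a smooth function `U` with `dU(X v) = 0` and `dU(i X v) = -v`, such that the fields `X v`, `i X v`
span an integrable distribution. -/
structure IsLocalGradientSystem (X : V →ₗ[ℝ] (E → E)) (U : E → V) (s : Set E) : Prop where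
  isOpen : IsOpen s
  differentiableOn : ∀ v, DifferentiableOn ℂ (X v) s
  contDiffOn : ContDiffOn ℝ ∞ U s
  fderiv_eq_zero : ∀ x ∈ s, ∀ v, fderiv ℝ U x (X v x) = 0
  fderiv_I_smul : ∀ x ∈ s, ∀ v, fderiv ℝ U x (Complex.I • X v x) = -v
  integrable : ∀ x ∈ s, ∃ g : E → E, ContDiffAt ℝ ∞ g x ∧ ∃ S : Submodule ℝ E, ∀ᶠ y in 𝓝 x,
    ∀ a, a ∈ complexSpan ((LinearMap.proj y).comp X) ↔ fderiv ℝ g y a ∈ S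

namespace IsLocalGradientSystem

variable {X : V →ₗ[ℝ] (E → E)} {U : E → V} {s : Set E}

theorem fderiv_add (h : IsLocalGradientSystem X U s) {x : E} (hx : x ∈ s) (a b : V) :
    fderiv ℝ U x (X a x + Complex.I • X b x) = -b := by
  rw [map_add, h.fderiv_eq_zero x hx, h.fderiv_I_smul x hx, zero_add]

/-- On ξ = X_a + iX_b, dU reads off -b, and once b = 0, dU(iξ) reads off -a. Both commutation and
linear independence rest on this. -/
theorem eq_zero_of_fderiv_eq_zero (h : IsLocalGradientSystem X U s) {x : E} (hx : x ∈ s) {a b : V}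
    (h1 : fderiv ℝ U x (X a x + Complex.I • X b x) = 0)
    (h2 : fderiv ℝ U x (Complex.I • (X a x + Complex.I • X b x)) = 0) : a = 0 ∧ b = 0 := by
  rw [h.fderiv_add hx, neg_eq_zero] at h1
  subst h1
  rw [map_zero, Pi.zero_apply, smul_zero, add_zero, h.fderiv_I_smul x hx, neg_eq_zero] at h2
  exact ⟨h2, rfl⟩

/-- The fields of a holomorphic gradient system commute. -/
theorem commute [FiniteDimensional ℂ E] (h : IsLocalGradientSystem X U s) {x : E} (hx : x ∈ s)
    (v w : V) : fderiv ℂ (X w) x (X v x) = fderiv ℂ (X v) x (X w x) := by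
  have : FiniteDimensional ℝ E := FiniteDimensional.complexToReal E
  have hs : s ∈ 𝓝 x := h.isOpen.mem_nhds hx
  have hX : ∀ v, HasFDerivAt (X v) ((fderiv ℂ (X v) x).restrictScalars ℝ) x := fun v =>
    ((h.differentiableOn v).differentiableAt hs).hasFDerivAt.restrictScalars ℝ
  have hIX : HasFDerivAt (fun y => Complex.I • X w y)
      ((Complex.I • fderiv ℂ (X w) x).restrictScalars ℝ) x :=
    (((h.differentiableOn w).differentiableAt hs).hasFDerivAt.const_smul
      Complex.I).restrictScalars ℝ
  have hU : ContDiffAt ℝ 2 U x := (h.contDiffOn.contDiffAt hs).of_le (WithTop.coe_le_coe.2 (le_top (a := (2 : ℕ∞))))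
  have h0 : ∀ v, ∀ᶠ y in 𝓝 x, fderiv ℝ U y (X v y) = 0 := fun v =>
    mem_of_superset hs fun y hy => h.fderiv_eq_zero y hy v
  have hU1 := hU.fderiv_bracket_eq_zero (hX v) (hX w) (h0 v) (h0 w)
  have hU2 := hU.fderiv_bracket_eq_zero (hX v) hIX (h0 v) (b := -w)
    (mem_of_superset hs fun y hy => h.fderiv_I_smul y hy w)
  -- Modulo S the differential of the flattening map g kills X_v and X_w near x, hence also their
  -- bracket.
  have hbr : fderiv ℂ (X w) x (X v x) - fderiv ℂ (X v) x (X w x) ∈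
      complexSpan ((LinearMap.proj x).comp X) := by
    obtain ⟨g, hg, S, hS⟩ := h.integrable x hx
    have hcl : IsClosed (S : Set E) := S.closed_of_finiteDimensional
    let π : E →L[ℝ] E ⧸ S := S.mkQ.toContinuousLinearMap
    have hg2 : ContDiffAt ℝ 2 g x := hg.of_le (WithTop.coe_le_coe.2 (le_top (a := (2 : ℕ∞))))
    have hπg : ContDiffAt ℝ 2 (π ∘ g) x := π.contDiff.contDiffAt.comp x hg2
    have hder : ∀ᶠ y in 𝓝 x, ∀ a, fderiv ℝ (π ∘ g) y a = π (fderiv ℝ g y a) := by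
      have hdiff : ∀ᶠ y in 𝓝 x, DifferentiableAt ℝ g y :=
        (hg2.eventually (by simp)).mono fun y hy => hy.differentiableAt two_ne_zero
      filter_upwards [hdiff] with y hy a
      rw [(π.hasFDerivAt.comp y hy.hasFDerivAt).fderiv]
      rfl
    have hmem : ∀ v, ∀ᶠ y in 𝓝 x, fderiv ℝ (π ∘ g) y (X v y) = 0 := fun v => by
      filter_upwards [hder, hS] with y hy hyS
      rw [hy]
      refine (Submodule.Quotient.mk_eq_zero S).2 ((hyS _).1 (mem_complexSpan.2 ⟨v, 0, ?_⟩))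
      simp
    have hb := hπg.fderiv_bracket_eq_zero (hX v) (hX w) (hmem v) (hmem w)
    rw [hder.self_of_nhds] at hb
    exact (hS.self_of_nhds _).2 ((Submodule.Quotient.mk_eq_zero S).1 hb)
  obtain ⟨a, b, hab⟩ := mem_complexSpan.1 hbr
  have hab' : X a x + Complex.I • X b x =
      fderiv ℂ (X w) x (X v x) - fderiv ℂ (X v) x (X w x) := hab
  have e1 : fderiv ℝ U x (X a x + Complex.I • X b x) = 0 := by
    rw [hab']
    exact hU1
  have e2 : fderiv ℝ U x (Complex.I • (X a x + Complex.I • X b x)) = 0 := by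
    -- Complex linearity of the derivative of X_v identifies i[X_v, X_w] with [X_v, iX_w].
    rw [hab', smul_sub, ← (fderiv ℂ (X v) x).map_smul]
    exact hU2
  obtain ⟨rfl, rfl⟩ := h.eq_zero_of_fderiv_eq_zero hx e1 e2
  rw [← sub_eq_zero, ← hab']
  simp

end IsLocalGradientSystem

end Local

end ComplexGradient

namespace ComplexGradient

/-! ### Simultaneous straightening of commuting holomorphic fields. -/

section Straightening

variable {n k : ℕ}

/-- `zPart` as a continuous linear map. -/
noncomputable def zPartL : EuclideanSpace ℂ (Fin (n + k)) →L[ℂ] EuclideanSpace ℂ (Fin n) :=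
  LinearMap.toContinuousLinearMap
    { toFun := zPart, map_add' := fun _ _ => rfl, map_smul' := fun _ _ => rfl }

/-- `wPart` as a continuous linear map. -/
noncomputable def wPartL : EuclideanSpace ℂ (Fin (n + k)) →L[ℂ] EuclideanSpace ℂ (Fin k) :=
  LinearMap.toContinuousLinearMap
    { toFun := wPart, map_add' := fun _ _ => rfl, map_smul' := fun _ _ => rfl }

@[simp] theorem zPartL_apply (c : EuclideanSpace ℂ (Fin (n + k))) : zPartL c = zPart c := rfl

@[simp] theorem wPartL_apply (c : EuclideanSpace ℂ (Fin (n + k))) : wPartL c = wPart c := rfl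

/-- The point with coordinates `(z, w)`. -/
noncomputable def ofParts : EuclideanSpace ℂ (Fin n) × EuclideanSpace ℂ (Fin k) →L[ℂ]
    EuclideanSpace ℂ (Fin (n + k)) :=
  LinearMap.toContinuousLinearMap
    { toFun := fun q => WithLp.toLp 2 (Fin.append q.1 q.2)
      map_add' := fun q r => by
        ext i
        refine Fin.addCases (fun i => ?_) (fun i => ?_) i <;> simp
      map_smul' := fun a q => by
        ext i
        refine Fin.addCases (fun i => ?_) (fun i => ?_) i <;> simp }

theorem ofParts_apply (q : EuclideanSpace ℂ (Fin n) × EuclideanSpace ℂ (Fin k)) :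
    ofParts q = WithLp.toLp 2 (Fin.append q.1 q.2) := rfl

@[simp] theorem zPart_ofParts (q : EuclideanSpace ℂ (Fin n) × EuclideanSpace ℂ (Fin k)) :
    zPart (ofParts q) = q.1 := by
  ext i; simp [zPart, ofParts_apply]

@[simp] theorem wPart_ofParts (q : EuclideanSpace ℂ (Fin n) × EuclideanSpace ℂ (Fin k)) :
    wPart (ofParts q) = q.2 := by
  ext i; simp [wPart, ofParts_apply]

@[simp] theorem ofParts_zPart_wPart (c : EuclideanSpace ℂ (Fin (n + k))) :
    ofParts (zPart c, wPart c) = c := by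
  ext i
  refine Fin.addCases (fun i => ?_) (fun i => ?_) i <;> simp [zPart, wPart, ofParts_apply]

theorem ofParts_zero_single (α : Fin k) :
    ofParts ((0 : EuclideanSpace ℂ (Fin n)), EuclideanSpace.single α (1 : ℂ)) = tVector α := by
  ext i
  refine Fin.addCases (fun i => ?_) (fun i => ?_) i
  · simp [ofParts_apply, tVector, Fin.ext_iff]
    omega
  · simp [ofParts_apply, tVector, Pi.single_apply]

/-- An injective linear map `ℂᵏ → ℂⁿ⁺ᵏ` extends to an automorphism of `ℂⁿ⁺ᵏ`. -/
theorem exists_extension {A : EuclideanSpace ℂ (Fin k) →L[ℂ] EuclideanSpace ℂ (Fin (n + k))}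
    (hA : Function.Injective A) :
    ∃ (θ : EuclideanSpace ℂ (Fin n) →L[ℂ] EuclideanSpace ℂ (Fin (n + k)))
      (T : EuclideanSpace ℂ (Fin (n + k)) ≃L[ℂ] EuclideanSpace ℂ (Fin (n + k))),
      ∀ c, T c = θ (zPart c) + A (wPart c) := by
  -- A complement of the k-dimensional range has dimension n, so θ can be an isomorphism of ℂⁿ onto
  -- it.
  obtain ⟨C, hC⟩ := Submodule.exists_isCompl (LinearMap.range A.toLinearMap)
  have hdim : Module.finrank ℂ (EuclideanSpace ℂ (Fin n)) = Module.finrank ℂ C := by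
    have h1 := Submodule.finrank_add_eq_of_isCompl hC
    have h2 : Module.finrank ℂ (LinearMap.range A.toLinearMap) = k := by
      rw [LinearMap.finrank_range_of_inj hA]
      simp
    simp only [finrank_euclideanSpace, Fintype.card_fin] at h1 ⊢
    omega
  let e := LinearEquiv.ofFinrankEq _ _ hdim
  let θ : EuclideanSpace ℂ (Fin n) →L[ℂ] EuclideanSpace ℂ (Fin (n + k)) :=
    (C.subtype.comp e.toLinearMap).toContinuousLinearMap
  let L : EuclideanSpace ℂ (Fin (n + k)) →L[ℂ] EuclideanSpace ℂ (Fin (n + k)) :=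
    θ ∘L zPartL + A ∘L wPartL
  have hL : Function.Injective L.toLinearMap := by
    rw [injective_iff_map_eq_zero]
    intro c hc
    have h1 : ((e (zPart c) : C) : EuclideanSpace ℂ (Fin (n + k))) + A (wPart c) = 0 := hc
    have h2 : ((e (zPart c) : C) : EuclideanSpace ℂ (Fin (n + k))) ∈
        LinearMap.range A.toLinearMap := by
      rw [eq_neg_of_add_eq_zero_left h1, ← map_neg]
      exact ⟨_, rfl⟩
    have h3 : ((e (zPart c) : C) : EuclideanSpace ℂ (Fin (n + k))) = 0 :=
      Submodule.disjoint_def.1 hC.disjoint _ h2 (e (zPart c)).2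
    rw [h3, zero_add] at h1
    have h4 : wPart c = 0 := hA (by rw [h1, map_zero])
    have h5 : zPart c = 0 := e.injective (by rw [map_zero]; exact Subtype.ext h3)
    rw [← ofParts_zPart_wPart c, h4, h5]
    exact map_zero _
  exact ⟨θ, (LinearEquiv.ofInjectiveEndo L.toLinearMap hL).toContinuousLinearEquiv, fun c => rfl⟩

/-- Commuting holomorphic vector fields that are linearly independent at a point are coordinate
fields in suitable holomorphic coordinates on a polydisc. -/
theorem exists_straightening
    {X : EuclideanSpace ℂ (Fin (n + k)) →
      EuclideanSpace ℂ (Fin k) →L[ℂ] EuclideanSpace ℂ (Fin (n + k))}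
    {s : Set (EuclideanSpace ℂ (Fin (n + k)))} (hs : IsOpen s) (hX : DifferentiableOn ℂ X s)
    (hcomm : ∀ x ∈ s, ∀ v w, fderiv ℂ X x (X x v) w = fderiv ℂ X x (X x w) v)
    {x₀ : EuclideanSpace ℂ (Fin (n + k))} (hx₀ : x₀ ∈ s) (hinj : Function.Injective (X x₀)) :
    ∃ Φ : OpenPartialHomeomorph (EuclideanSpace ℂ (Fin (n + k))) (EuclideanSpace ℂ (Fin (n + k))),
      ∃ r > 0, Φ.source = {c | zPart c ∈ ball 0 r ∧ wPart c ∈ ball 0 r} ∧ x₀ ∈ Φ.target ∧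
      Φ.target ⊆ s ∧ ContDiffOn ℂ ω Φ Φ.source ∧ ContDiffOn ℂ ω Φ.symm Φ.target ∧
      ∀ c ∈ Φ.source, ∀ v, fderiv ℂ Φ c (ofParts (0, v)) = X (Φ c) v := by
  obtain ⟨Ψ, hΨ₀, hΨev, hΨd⟩ := exists_flow_of_commute hs hX hcomm hx₀
  obtain ⟨θ, T, hT⟩ := exists_extension hinj
  let L : EuclideanSpace ℂ (Fin (n + k)) →L[ℂ]
      EuclideanSpace ℂ (Fin (n + k)) × EuclideanSpace ℂ (Fin k) := (θ ∘L zPartL).prod wPartL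
  -- The flow starts on the transversal x₀ + θ(z) and runs for the parameter w. At the origin the
  -- differential of f is θ(z) + X(x₀)w, which is the automorphism T.
  let ℓ : EuclideanSpace ℂ (Fin (n + k)) →
      EuclideanSpace ℂ (Fin (n + k)) × EuclideanSpace ℂ (Fin k) := fun c => (x₀, 0) + L c
  have hℓ : ∀ c, HasFDerivAt ℓ L c := fun c => L.hasFDerivAt.const_add _
  have hℓ₀ : ℓ 0 = (x₀, 0) := by simp [ℓ]
  let f := Ψ ∘ ℓ
  have hf₀ : f 0 = x₀ := by simp only [f, Function.comp_apply, hℓ₀, hΨ₀]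
  have hfd : ∀ c, DifferentiableAt ℂ Ψ (ℓ c) → HasFDerivAt f (fderiv ℂ Ψ (ℓ c) ∘L L) c :=
    fun c hc => hc.hasFDerivAt.comp c (hℓ c)
  have hev : ∀ᶠ c in 𝓝 (0 : EuclideanSpace ℂ (Fin (n + k))), f c ∈ s ∧ DifferentiableAt ℂ f c ∧
      ∀ v, fderiv ℂ f c (ofParts (0, v)) = X (f c) v := by
    have h1 : Tendsto ℓ (𝓝 0) (𝓝 (x₀, 0)) := by
      have := (hℓ 0).continuousAt.tendsto
      rwa [hℓ₀] at this
    filter_upwards [h1.eventually hΨev] with c hc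
    refine ⟨hc.1, (hfd c hc.2.1).differentiableAt, fun v => ?_⟩
    rw [(hfd c hc.2.1).fderiv]
    have : L (ofParts (0, v)) = (0, v) := by simp [L]
    rw [ContinuousLinearMap.comp_apply, this]
    exact hc.2.2 v
  obtain ⟨N, hN, hNo, h0N⟩ := _root_.mem_nhds_iff.1 hev
  have hfN : ContDiffOn ℂ ω f N := by
    have h1 : DifferentiableOn ℂ f N := fun c hc => (hN hc).2.1.differentiableWithinAt
    exact (h1.analyticOnNhd_complex hNo).contDiffOn hNo.uniqueDiffOn
  have hfω : ∀ c ∈ N, ContDiffAt ℂ ω f c := fun c hc => hfN.contDiffAt (hNo.mem_nhds hc)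
  have hT₀ : fderiv ℂ f 0 = T := by
    have h1 := hΨev.self_of_nhds
    have h2 : DifferentiableAt ℂ Ψ (ℓ 0) := by rw [hℓ₀]; exact h1.2.1
    rw [(hfd 0 h2).fderiv, hℓ₀]
    ext1 c
    rw [ContinuousLinearMap.comp_apply]
    exact (hΨd _ _).trans (hT c).symm
  have hfT : HasFDerivAt f (T : EuclideanSpace ℂ (Fin (n + k)) →L[ℂ] _) 0 :=
    hT₀ ▸ (hN h0N).2.1.hasFDerivAt
  let Φ₀ := (hfω 0 h0N).toOpenPartialHomeomorph f hfT (by simp)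
  have hΦ₀ : (0 : EuclideanSpace ℂ (Fin (n + k))) ∈ Φ₀.source :=
    (hfω 0 h0N).mem_toOpenPartialHomeomorph_source hfT (by simp)
  have hequiv : ∀ᶠ c in 𝓝 (0 : EuclideanSpace ℂ (Fin (n + k))), 
      (fderiv ℂ f c).IsInvertible := by
    have h1 : ContinuousAt (fderiv ℂ f) 0 :=
      ((hfω 0 h0N).fderiv_right (m := 0) (by simp)).continuousAt
    refine h1.eventually (p := ContinuousLinearMap.IsInvertible) ?_
    rw [hT₀]
    exact T.nhds
  have hgood := (hequiv.and (hNo.mem_nhds h0N)).and (Φ₀.open_source.mem_nhds hΦ₀)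
  have hpart : Tendsto (ofParts (n := n) (k := k)) (𝓝 0) (𝓝 0) := by
    have := (ofParts (n := n) (k := k)).continuous.tendsto 0
    rwa [map_zero] at this
  obtain ⟨r, hr, hball⟩ := Metric.mem_nhds_iff.1 (hpart.eventually hgood)
  -- A product domain: over each z the w-slice is a ball containing 0, which later makes a function
  -- with zero w-derivative depend on z alone.
  let box : Set (EuclideanSpace ℂ (Fin (n + k))) := {c | zPart c ∈ ball 0 r ∧ wPart c ∈ ball 0 r}
  have hbo : IsOpen box :=
    (isOpen_ball.preimage (zPartL (n := n) (k := k)).continuous).inter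
      (isOpen_ball.preimage (wPartL (n := n) (k := k)).continuous)
  have hbox : ∀ c ∈ box, ((fderiv ℂ f c).IsInvertible ∧ c ∈ N) ∧ c ∈ Φ₀.source := by
    intro c hc
    have : (zPart c, wPart c) ∈ ball
        (0 : EuclideanSpace ℂ (Fin n) × EuclideanSpace ℂ (Fin k)) r := by
      rw [← Prod.mk_zero_zero, ← ball_prod_same]
      exact ⟨hc.1, hc.2⟩
    have := hball this
    rwa [mem_ofPred_eq, ofParts_zPart_wPart] at this
  have hsrc : (Φ₀.restrOpen box hbo).source = box := by
    rw [OpenPartialHomeomorph.restrOpen_source]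
    exact inter_eq_right.2 fun c hc => (hbox c hc).2
  have hcoe' : (Φ₀.restrOpen box hbo : EuclideanSpace ℂ (Fin (n + k)) → _) = f := rfl
  have h0box : (0 : EuclideanSpace ℂ (Fin (n + k))) ∈ box := by
    have h1 : zPart (0 : EuclideanSpace ℂ (Fin (n + k))) = 0 := (zPartL (n := n) (k := k)).map_zero
    have h2 : wPart (0 : EuclideanSpace ℂ (Fin (n + k))) = 0 := (wPartL (n := n) (k := k)).map_zero
    exact ⟨h1 ▸ mem_ball_self hr, h2 ▸ mem_ball_self hr⟩
  refine ⟨Φ₀.restrOpen box hbo, r, hr, hsrc, ?_, ?_, ?_, ?_, ?_⟩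
  · have h1 : (0 : EuclideanSpace ℂ (Fin (n + k))) ∈ (Φ₀.restrOpen box hbo).source := by
      rw [hsrc]
      exact h0box
    have h2 := (Φ₀.restrOpen box hbo).map_source h1
    rwa [hcoe', hf₀] at h2
  · intro y hy
    have h1 := (Φ₀.restrOpen box hbo).map_target hy
    rw [← (Φ₀.restrOpen box hbo).right_inv hy]
    rw [hsrc] at h1
    exact (hN (hbox _ h1).1.2).1
  · rw [hsrc, hcoe']
    exact hfN.mono fun c hc => (hbox c hc).1.2
  · intro y hy
    have h1 := (Φ₀.restrOpen box hbo).map_target hy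
    rw [hsrc] at h1
    obtain ⟨⟨⟨T', hT'⟩, hcN⟩, -⟩ := hbox _ h1
    refine ContDiffAt.contDiffWithinAt ?_
    refine (Φ₀.restrOpen box hbo).contDiffAt_symm (f₀' := T') hy ?_ (hfω _ hcN)
    rw [hT']
    exact (hN hcN).2.1.hasFDerivAt
  · intro c hc v
    rw [hsrc] at hc
    rw [hcoe', (hN (hbox c hc).1.2).2.2 v]

end Straightening

end ComplexGradient

namespace ComplexGradient

/-! ### Complex extension of the fields and the local normal form. -/

section LocalCoordinates

variable {n k : ℕ} {E : Type*} [NormedAddCommGroup E] [NormedSpace ℂ E]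

/-- The real part of a vector of `ℂᵏ`. -/
noncomputable def reVec : EuclideanSpace ℂ (Fin k) →L[ℝ] EuclideanSpace ℝ (Fin k) :=
  LinearMap.toContinuousLinearMap
    { toFun := fun w => WithLp.toLp 2 fun i => (w i).re
      map_add' := fun _ _ => by ext; simp
      map_smul' := fun _ _ => by ext; simp }

/-- The imaginary part of a vector of `ℂᵏ`. -/
noncomputable def imVec : EuclideanSpace ℂ (Fin k) →L[ℝ] EuclideanSpace ℝ (Fin k) :=
  LinearMap.toContinuousLinearMap
    { toFun := fun w => WithLp.toLp 2 fun i => (w i).im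
      map_add' := fun _ _ => by ext; simp
      map_smul' := fun _ _ => by ext; simp }

@[simp] theorem reVec_apply (w : EuclideanSpace ℂ (Fin k)) (i : Fin k) :
    reVec w i = (w i).re := rfl

@[simp] theorem imVec_apply (w : EuclideanSpace ℂ (Fin k)) (i : Fin k) :
    imVec w i = (w i).im := rfl

theorem uPart_eq_imVec (c : EuclideanSpace ℂ (Fin (n + k))) : uPart c = imVec (wPart c) := rfl

/-- The complex linear extension `ℂᵏ → E` of a real linear map `ℝᵏ → E`. -/
noncomputable def complexExtension (A : EuclideanSpace ℝ (Fin k) →ₗ[ℝ] E) :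
    EuclideanSpace ℂ (Fin k) →L[ℂ] E :=
  ∑ α, (EuclideanSpace.proj α : EuclideanSpace ℂ (Fin k) →L[ℂ] ℂ).smulRight
    (A (EuclideanSpace.single α 1))

theorem complexExtension_apply (A : EuclideanSpace ℝ (Fin k) →ₗ[ℝ] E)
    (w : EuclideanSpace ℂ (Fin k)) :
    complexExtension A w = ∑ α, w α • A (EuclideanSpace.single α 1) := by
  simp [complexExtension]

theorem complexExtension_single (A : EuclideanSpace ℝ (Fin k) →ₗ[ℝ] E) (α : Fin k) :
    complexExtension A (EuclideanSpace.single α 1) = A (EuclideanSpace.single α 1) := by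
  rw [complexExtension_apply, Finset.sum_eq_single α] <;> simp +contextual

theorem complexExtension_eq (A : EuclideanSpace ℝ (Fin k) →ₗ[ℝ] E)
    (w : EuclideanSpace ℂ (Fin k)) :
    complexExtension A w = A (reVec w) + Complex.I • A (imVec w) := by
  have h : ∀ v : EuclideanSpace ℝ (Fin k),
      A v = ∑ α, (v α : ℂ) • A (EuclideanSpace.single α 1) := by
    intro v
    conv_lhs => rw [← (EuclideanSpace.basisFun (Fin k) ℝ).sum_repr v]
    simp [map_sum, EuclideanSpace.basisFun_apply]
  rw [complexExtension_apply, h (reVec w), h (imVec w), Finset.smul_sum, ← Finset.sum_add_distrib]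
  refine Finset.sum_congr rfl fun α _ => ?_
  rw [smul_smul, ← add_smul]
  congr 1
  rw [reVec_apply, imVec_apply, mul_comm]
  exact (Complex.re_add_im _).symm

variable {X : EuclideanSpace ℝ (Fin k) →ₗ[ℝ] (E → E)}
  {U : E → EuclideanSpace ℝ (Fin k)} {s : Set E}

namespace IsLocalGradientSystem

theorem hasFDerivAt_complexExtension (h : IsLocalGradientSystem X U s) {x : E} (hx : x ∈ s) :
    HasFDerivAt (fun y => complexExtension ((LinearMap.proj y).comp X))
      (∑ α, ((ContinuousLinearMap.smulRightL ℂ (EuclideanSpace ℂ (Fin k)) E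
        (EuclideanSpace.proj α)) ∘L fderiv ℂ (X (EuclideanSpace.single α 1)) x)) x := by
  unfold complexExtension
  refine HasFDerivAt.fun_sum fun α _ => ?_
  have h1 := ((h.differentiableOn (EuclideanSpace.single α 1)).differentiableAt
    (h.isOpen.mem_nhds hx)).hasFDerivAt
  exact (ContinuousLinearMap.smulRightL ℂ (EuclideanSpace ℂ (Fin k)) E
        (EuclideanSpace.proj α)).hasFDerivAt.comp x h1

/-- Both sides are complex bilinear in v and w, so commutation of the basis fields suffices. -/
theorem fderiv_complexExtension_comm [FiniteDimensional ℂ E] (h : IsLocalGradientSystem X U s)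
    {x : E} (hx : x ∈ s) (v w : EuclideanSpace ℂ (Fin k)) :
    fderiv ℂ (fun y => complexExtension ((LinearMap.proj y).comp X)) x
        (complexExtension ((LinearMap.proj x).comp X) v) w =
      fderiv ℂ (fun y => complexExtension ((LinearMap.proj y).comp X)) x
        (complexExtension ((LinearMap.proj x).comp X) w) v := by
  have key : ∀ v w : EuclideanSpace ℂ (Fin k),
      fderiv ℂ (fun y => complexExtension ((LinearMap.proj y).comp X)) x
        (complexExtension ((LinearMap.proj x).comp X) v) w =
      ∑ α, ∑ β, (w α * v β) • fderiv ℂ (X (EuclideanSpace.single α 1)) x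
        (X (EuclideanSpace.single β 1) x) := by
    intro v w
    rw [(h.hasFDerivAt_complexExtension hx).fderiv, complexExtension_apply,
      _root_.sum_apply, _root_.sum_apply]
    refine Finset.sum_congr rfl fun α _ => ?_
    change w α • fderiv ℂ (X (EuclideanSpace.single α 1)) x
      (∑ β, v β • X (EuclideanSpace.single β 1) x) = _
    rw [map_sum, Finset.smul_sum]
    exact Finset.sum_congr rfl fun β _ => by rw [map_smul, smul_smul]
  rw [key, key, Finset.sum_comm]
  refine Finset.sum_congr rfl fun β _ => Finset.sum_congr rfl fun α _ => ?_
  rw [h.commute hx, mul_comm]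

/-- A kernel vector w gives X(Re w) + iX(Im w) = 0, and the gradient equations recover Re w and Im w
from this vector. -/
theorem complexExtension_injective (h : IsLocalGradientSystem X U s) {x : E} (hx : x ∈ s) :
    Function.Injective (complexExtension ((LinearMap.proj x).comp X)) := by
  rw [injective_iff_map_eq_zero]
  intro w hw
  rw [complexExtension_eq] at hw
  have hw' : X (reVec w) x + Complex.I • X (imVec w) x = 0 := hw
  obtain ⟨h1, h2⟩ := h.eq_zero_of_fderiv_eq_zero hx (by rw [hw', map_zero])
    (by rw [hw', smul_zero, map_zero])
  ext i
  have h3 := congrArg (fun v : EuclideanSpace ℝ (Fin k) => v i) h1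
  have h4 := congrArg (fun v : EuclideanSpace ℝ (Fin k) => v i) h2
  exact Complex.ext h3 h4

theorem fderiv_complexExtension_apply (h : IsLocalGradientSystem X U s) {x : E} (hx : x ∈ s)
    (w : EuclideanSpace ℂ (Fin k)) :
    fderiv ℝ U x (complexExtension ((LinearMap.proj x).comp X) w) = -imVec w := by
  rw [complexExtension_eq]
  exact h.fderiv_add hx _ _

end IsLocalGradientSystem

/-- The normal form of a holomorphic gradient system in a holomorphic chart. -/
theorem IsLocalGradientSystem.exists_coordinates
    {X : EuclideanSpace ℝ (Fin k) →ₗ[ℝ]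
      (EuclideanSpace ℂ (Fin (n + k)) → EuclideanSpace ℂ (Fin (n + k)))}
    {U : EuclideanSpace ℂ (Fin (n + k)) → EuclideanSpace ℝ (Fin k)}
    {s : Set (EuclideanSpace ℂ (Fin (n + k)))} (h : IsLocalGradientSystem X U s)
    {x₀ : EuclideanSpace ℂ (Fin (n + k))} (hx₀ : x₀ ∈ s) :
    ∃ Φ : OpenPartialHomeomorph (EuclideanSpace ℂ (Fin (n + k))) (EuclideanSpace ℂ (Fin (n + k))),
      x₀ ∈ Φ.target ∧ Φ.target ⊆ s ∧ ContDiffOn ℂ ω Φ Φ.source ∧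
      ContDiffOn ℂ ω Φ.symm Φ.target ∧
      (∀ c ∈ Φ.source, ∀ α,
        fderiv ℂ Φ c (tVector α) = X (EuclideanSpace.single α 1) (Φ c)) ∧
      ∃ F : EuclideanSpace ℂ (Fin n) → EuclideanSpace ℝ (Fin k),
        ContDiffOn ℝ ∞ F (zPart '' Φ.source) ∧
        ∀ c ∈ Φ.source, U (Φ c) = F (zPart c) - uPart c := by
  obtain ⟨Φ, r, hr, hsrc, hx₀Φ, hΦs, hΦ, hΦ', hder⟩ := exists_straightening h.isOpen
    (fun x hx => (h.hasFDerivAt_complexExtension hx).differentiableAt.differentiableWithinAt)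
    (fun x hx v w => h.fderiv_complexExtension_comm hx v w) hx₀ (h.complexExtension_injective hx₀)
  have hmem : ∀ z ∈ ball (0 : EuclideanSpace ℂ (Fin n)) r,
      ∀ w ∈ ball (0 : EuclideanSpace ℂ (Fin k)) r, ofParts (z, w) ∈ Φ.source := by
    intro z hz w hw
    rw [hsrc]
    exact ⟨by simpa using hz, by simpa using hw⟩
  have hUΦ : ContDiffOn ℝ ∞ (U ∘ Φ) Φ.source :=
    h.contDiffOn.comp ((hΦ.restrict_scalars ℝ).of_le le_top)
      fun c hc => hΦs (Φ.map_source hc)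
  have hd : ∀ c ∈ Φ.source, ∀ v, fderiv ℝ (U ∘ Φ) c (ofParts (0, v)) = -imVec v := by
    intro c hc v
    have hs := hΦs (Φ.map_source hc)
    have h1 : HasFDerivAt Φ (fderiv ℂ Φ c) c :=
      ((hΦ.contDiffAt (Φ.open_source.mem_nhds hc)).differentiableAt (by simp)).hasFDerivAt
    have h2 : DifferentiableAt ℝ U (Φ c) :=
      (h.contDiffOn.contDiffAt (h.isOpen.mem_nhds hs)).differentiableAt (by simp)
    rw [(h2.hasFDerivAt.comp c (h1.restrictScalars ℝ)).fderiv]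
    exact (congrArg _ (hder c hc v)).trans (h.fderiv_complexExtension_apply hs v)
  -- F is U on the slice w = 0, which lies in the polydisc over every admissible z.
  refine ⟨Φ, hx₀Φ, hΦs, hΦ, hΦ', fun c hc α => ?_, fun z => U (Φ (ofParts (z, 0))), ?_, ?_⟩
  · rw [← ofParts_zero_single, hder c hc, complexExtension_single]
    rfl
  · have hz : MapsTo (fun z : EuclideanSpace ℂ (Fin n) => ofParts (z, (0 : EuclideanSpace ℂ (Fin k))))
        (zPart '' Φ.source) Φ.source := by
      rintro _ ⟨c, hc, rfl⟩
      rw [hsrc] at hc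
      exact hmem _ hc.1 _ (mem_ball_self hr)
    have hlin : ContDiff ℝ ∞
        (fun z : EuclideanSpace ℂ (Fin n) => ofParts (z, (0 : EuclideanSpace ℂ (Fin k)))) :=
      ((ofParts (n := n) (k := k) ∘L ContinuousLinearMap.inl ℂ _ _).restrictScalars ℝ).contDiff
    exact hUΦ.comp hlin.contDiffOn hz
  · intro c hc
    have hc' := hc
    rw [hsrc] at hc'
    -- For fixed z this is U + u. Its derivative vanishes on the w-ball by `hd`, so its values at w
    -- and at 0 agree.
    let g : EuclideanSpace ℂ (Fin k) → EuclideanSpace ℝ (Fin k) := fun w =>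
      (U ∘ Φ) (ofParts (zPart c, w)) + imVec w
    have hg : ∀ w ∈ ball (0 : EuclideanSpace ℂ (Fin k)) r,
        HasFDerivAt g (0 : EuclideanSpace ℂ (Fin k) →L[ℝ] EuclideanSpace ℝ (Fin k)) w := by
      intro w hw
      have hmw := hmem _ hc'.1 w hw
      have h1 : HasFDerivAt (U ∘ Φ) (fderiv ℝ (U ∘ Φ) (ofParts (zPart c, w)))
          (ofParts (zPart c, w)) :=
        ((hUΦ.contDiffAt (Φ.open_source.mem_nhds hmw)).differentiableAt (by simp)).hasFDerivAt
      have h2 : HasFDerivAt (fun w => ofParts (zPart c, w))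
          ((ofParts (n := n) (k := k) ∘L ContinuousLinearMap.inr ℂ _ _).restrictScalars ℝ) w :=
        (ofParts.hasFDerivAt.comp w (hasFDerivAt_prodMk_right (𝕜 := ℂ) _ _)).restrictScalars ℝ
      refine ((h1.comp w h2).add imVec.hasFDerivAt).congr_fderiv ?_
      ext1 v
      exact (congrArg (· + imVec v) (hd _ hmw v)).trans (neg_add_cancel _)
    have hconst := isOpen_ball.is_const_of_fderiv_eq_zero (𝕜 := ℝ)
      (convex_ball (0 : EuclideanSpace ℂ (Fin k)) r).isPreconnected
      (fun w hw => (hg w hw).differentiableAt.differentiableWithinAt)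
      (fun w hw => (hg w hw).fderiv) hc'.2 (mem_ball_self hr)
    simp only [g, Function.comp_apply, ofParts_zPart_wPart, map_zero, add_zero] at hconst
    change _ = U (Φ (ofParts (zPart c, 0))) - _
    rw [← hconst, uPart_eq_imVec, add_sub_cancel_right]

end LocalCoordinates

end ComplexGradient

namespace ComplexGradient

/-! ### Real differentials of holomorphic charts. -/

section Charts

variable {E : Type*} [NormedAddCommGroup E] [NormedSpace ℂ E]
  {M : Type*} [TopologicalSpace M] [ChartedSpace E M]

/-- A complex differential is also the real differential. -/
theorem hasMFDerivAt_restrictScalars {F : Type*} [NormedAddCommGroup F] [NormedSpace ℂ F]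
    {f : M → F} {q : M} {f' : E →L[ℂ] F} (h : HasMFDerivAt 𝓘(ℂ, E) 𝓘(ℂ, F) f q f') :
    HasMFDerivAt 𝓘(ℝ, E) 𝓘(ℝ, F) f q (f'.restrictScalars ℝ : E →L[ℝ] F) :=
  ⟨h.1, h.2.restrictScalars ℝ⟩

variable (E) in
/-- The real differential of a vector valued function, as a map on the model space. -/
noncomputable def realDeriv {F : Type*} [NormedAddCommGroup F] [NormedSpace ℝ F] (f : M → F)
    (q : M) : E →L[ℝ] F :=
  mfderiv 𝓘(ℝ, E) 𝓘(ℝ, F) f q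

/-- The differential of a holomorphic chart is complex linear. -/
theorem realDeriv_I_smul {c : OpenPartialHomeomorph M E} [IsManifold 𝓘(ℂ, E) ω M]
    (hc : c ∈ IsManifold.maximalAtlas 𝓘(ℂ, E) ω M) {q : M} (hq : q ∈ c.source) (v : E) :
    realDeriv E c q (Complex.I • v) = Complex.I • realDeriv E c q v := by
  have h1 : HasMFDerivAt 𝓘(ℂ, E) 𝓘(ℂ, E) c q (mfderiv 𝓘(ℂ, E) 𝓘(ℂ, E) c q) :=
    (((contMDiffOn_of_mem_maximalAtlas hc).contMDiffAt
      (c.open_source.mem_nhds hq)).mdifferentiableAt (by simp)).hasMFDerivAt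
  have h2 : realDeriv E c q =
      (mfderiv 𝓘(ℂ, E) 𝓘(ℂ, E) c q : E →L[ℂ] E).restrictScalars ℝ :=
    (hasMFDerivAt_restrictScalars h1).mfderiv
  rw [h2]
  exact (mfderiv 𝓘(ℂ, E) 𝓘(ℂ, E) c q : E →L[ℂ] E).map_smul Complex.I v

theorem mem_maximalAtlas_real {c : OpenPartialHomeomorph M E}
    (hc : c ∈ IsManifold.maximalAtlas 𝓘(ℂ, E) ω M) :
    c ∈ IsManifold.maximalAtlas 𝓘(ℝ, E) ω M := by
  have hle : contDiffGroupoid ω 𝓘(ℂ, E) ≤ contDiffGroupoid ω 𝓘(ℝ, E) :=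
    StructureGroupoid.le_iff.2 fun _ he => ⟨he.1.restrict_scalars ℝ, he.2.restrict_scalars ℝ⟩
  exact StructureGroupoid.maximalAtlas_mono hle hc

/-- The chain rule in a chart. -/
theorem fderiv_comp_chart_symm {c : OpenPartialHomeomorph M E}
    (hc : c.MDifferentiable 𝓘(ℝ, E) 𝓘(ℝ, E)) {F : Type*} [NormedAddCommGroup F] [NormedSpace ℝ F]
    {f : M → F} {y : E} (hy : y ∈ c.target) (hf : MDifferentiableAt 𝓘(ℝ, E) 𝓘(ℝ, F) f (c.symm y))
    (v : E) :
    fderiv ℝ (f ∘ c.symm) y (realDeriv E c (c.symm y) v) = realDeriv E f (c.symm y) v := by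
  have h1 : mfderiv 𝓘(ℝ, E) 𝓘(ℝ, F) (f ∘ c.symm) y =
      (mfderiv 𝓘(ℝ, E) 𝓘(ℝ, F) f (c.symm y)).comp (mfderiv 𝓘(ℝ, E) 𝓘(ℝ, E) c.symm y) :=
    mfderiv_comp y hf (hc.mdifferentiableAt_symm hy)
  rw [mfderiv_eq_fderiv] at h1
  have h2 := hc.symm_comp_deriv (c.map_target hy)
  rw [c.right_inv hy] at h2
  have h3 := congrArg (fun L : TangentSpace 𝓘(ℝ, E) (c.symm y) →L[ℝ] _ => L v) h2
  exact (congrArg (fun L : E →L[ℝ] F => L (realDeriv E c (c.symm y) v)) h1).trans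
    (congrArg (realDeriv E f (c.symm y)) h3)

end Charts

/-! ### From the manifold to a chart. -/

section Systems

variable {E : Type*} [NormedAddCommGroup E] [NormedSpace ℂ E]
  {M : Type*} [TopologicalSpace M] [ChartedSpace E M]
  {V : Type*} [NormedAddCommGroup V] [NormedSpace ℝ V]

theorem mem_complexDistribution {ρ : V →ₗ[ℝ] (∀ q : M, TangentSpace 𝓘(ℝ, E) q)} {q : M}
    {v : TangentSpace 𝓘(ℝ, E) q} :
    v ∈ complexDistribution ρ q ↔ ∃ a b, ρ a q + J q (ρ b q) = v :=
  mem_complexSpan (E := E) (A := (LinearMap.proj q).comp ρ)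

/-- The fields `ρ(v)` expressed in a chart. -/
noncomputable def chartField (ρ : V →ₗ[ℝ] (∀ q : M, TangentSpace 𝓘(ℝ, E) q))
    (c : OpenPartialHomeomorph M E) : V →ₗ[ℝ] (E → E) where
  toFun v y := realDeriv E c (c.symm y) (ρ v (c.symm y))
  map_add' v w := by
    funext y
    rw [map_add]
    exact (realDeriv E c (c.symm y)).map_add _ _
  map_smul' a v := by
    funext y
    rw [map_smul]
    exact (realDeriv E c (c.symm y)).map_smul _ _

theorem chartField_apply (ρ : V →ₗ[ℝ] (∀ q : M, TangentSpace 𝓘(ℝ, E) q))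
    (c : OpenPartialHomeomorph M E) (v : V) (y : E) :
    chartField ρ c v y = realDeriv E c (c.symm y) (ρ v (c.symm y)) := rfl

variable [IsManifold 𝓘(ℂ, E) ω M]

/-- Complex linearity of dc gives ½dc(ξ) - (i/2)dc(iξ) = dc(ξ). Holomorphy of ρᶜ(v) therefore passes
to the chart expression of the real field ρ(v). -/
theorem coeff_complexified {ρ : V →ₗ[ℝ] (∀ q : M, TangentSpace 𝓘(ℝ, E) q)}
    {c : OpenPartialHomeomorph M E} (hc : c ∈ IsManifold.maximalAtlas 𝓘(ℂ, E) ω M) (v : V)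
    {q : M} (hq : q ∈ c.source) :
    (complexified ρ v).coeff c q = realDeriv E c q (ρ v q) := by
  have h : ∀ (d : E →L[ℝ] E) (x : E), d (Complex.I • x) = Complex.I • d x →
      d ((1 / 2 : ℝ) • x) + Complex.I • d (-((1 / 2 : ℝ) • Complex.I • x)) = d x := by
    intro d x hd
    rw [map_neg, map_smul, map_smul, hd, smul_neg, smul_comm Complex.I, smul_smul,
      Complex.I_mul_I, neg_smul, one_smul, smul_neg, neg_neg, ← add_smul]
    norm_num
  exact h (realDeriv E c q) (ρ v q) (realDeriv_I_smul hc hq _)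

/-- A holomorphic complex gradient system, seen in a holomorphic chart. -/
theorem IsComplexGradientSystem.isLocalGradientSystem [FiniteDimensional ℝ V]
    {ρ : V →ₗ[ℝ] (∀ q : M, TangentSpace 𝓘(ℝ, E) q)} {U : M → V}
    (hsys : IsComplexGradientSystem ρ U) (hhol : IsHolomorphicSystem ρ)
    {c : OpenPartialHomeomorph M E} (hc : c ∈ IsManifold.maximalAtlas 𝓘(ℂ, E) ω M) :
    IsLocalGradientSystem (chartField ρ c) (U ∘ c.symm) c.target := by
  have hcR := mem_maximalAtlas_real hc
  have hcs : ContMDiffOn 𝓘(ℝ, E) 𝓘(ℝ, E) ∞ c.symm c.target :=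
    (contMDiffOn_symm_of_mem_maximalAtlas hcR).of_le le_top
  have hcd : c.MDifferentiable 𝓘(ℝ, E) 𝓘(ℝ, E) :=
    ⟨(contMDiffOn_of_mem_maximalAtlas hcR).mdifferentiableOn (by simp),
      (contMDiffOn_symm_of_mem_maximalAtlas hcR).mdifferentiableOn (by simp)⟩
  have hUd : ∀ q, MDifferentiableAt 𝓘(ℝ, E) 𝓘(ℝ, V) U q := fun q =>
    hsys.smooth_gradient.mdifferentiable (by simp) q
  refine ⟨c.open_target, fun v => ?_, ?_, fun y hy v => ?_, fun y hy v => ?_, fun y hy => ?_⟩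
  · have h1 := ((hhol v).2 c hc).comp
      ((contMDiffOn_symm_of_mem_maximalAtlas hc).mdifferentiableOn (by simp))
      (fun y hy => c.map_target hy)
    refine (mdifferentiableOn_iff_differentiableOn.1 h1).congr fun y hy => ?_
    exact (coeff_complexified hc v (c.map_target hy)).symm
  · exact contMDiffOn_iff_contDiffOn.1 (hsys.smooth_gradient.comp_contMDiffOn hcs)
  · exact (fderiv_comp_chart_symm hcd hy (hUd _) _).trans (hsys.d_eq v _)
  · have h1 := realDeriv_I_smul hc (c.map_target hy) (ρ v (c.symm y))
    refine (congrArg (fderiv ℝ (U ∘ c.symm) y) h1.symm).trans ?_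
    exact (fderiv_comp_chart_symm hcd hy (hUd _) _).trans
      (neg_eq_iff_eq_neg.1 (hsys.dc_eq v _))
  -- The flattening map is the real chart e read through c; bijectivity of dc transports membership
  -- in the distribution.
  · obtain ⟨e, he, hpe, S, hS⟩ := hsys.integrable (c.symm y)
    have heM := contMDiffOn_of_mem_maximalAtlas he
    have hopen : IsOpen (c.symm.source ∩ c.symm ⁻¹' e.source) :=
      c.symm.isOpen_inter_preimage e.open_source
    have hnhds := hopen.mem_nhds ⟨hy, hpe⟩
    refine ⟨e ∘ c.symm, ?_, S, mem_of_superset hnhds fun y' hy' a => ?_⟩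
    · have h1 : ContMDiffOn 𝓘(ℝ, E) 𝓘(ℝ, E) ∞ (e ∘ c.symm) (c.symm.source ∩ c.symm ⁻¹' e.source) :=
        heM.comp (hcs.mono inter_subset_left) fun _ h => h.2
      exact (contMDiffOn_iff_contDiffOn.1 h1).contDiffAt hnhds
    · have hq := c.map_target hy'.1
      have hbij : Function.Bijective (realDeriv E c (c.symm y')) := hcd.mfderiv_bijective hq
      obtain ⟨v, rfl⟩ := hbij.2 a
      have hed : MDifferentiableAt 𝓘(ℝ, E) 𝓘(ℝ, E) e (c.symm y') :=
        (heM.contMDiffAt (e.open_source.mem_nhds hy'.2)).mdifferentiableAt (by simp)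
      rw [fderiv_comp_chart_symm hcd hy'.1 hed]
      let r : V → E := fun a => ρ a (c.symm y')
      have h1 : ∀ a b, chartField ρ c a y' + Complex.I • chartField ρ c b y' =
          realDeriv E c (c.symm y') v ↔
          r a + Complex.I • r b = v := by
        intro a b
        rw [← hbij.1.eq_iff (a := r a + Complex.I • r b), map_add, realDeriv_I_smul hc hq]
        rfl
      exact mem_complexSpan.trans ((exists_congr fun a => exists_congr fun b => h1 a b).trans
        (mem_complexDistribution.symm.trans (hS _ hy'.2 v)))

end Systems

end ComplexGradient

/-! ### The normal form on the manifold. -/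

theorem theorem5p1 {n k : ℕ} {M : Type*} [TopologicalSpace M]
    [ChartedSpace (EuclideanSpace ℂ (Fin (n + k))) M]
    [IsManifold 𝓘(ℂ, EuclideanSpace ℂ (Fin (n + k))) ω M]
    (ρ : EuclideanSpace ℝ (Fin k) →ₗ[ℝ]
      (∀ q : M, TangentSpace 𝓘(ℝ, EuclideanSpace ℂ (Fin (n + k))) q))
    (U : M → EuclideanSpace ℝ (Fin k))
    (hsys : ComplexGradient.IsComplexGradientSystem ρ U)
    (hhol : ComplexGradient.IsHolomorphicSystem ρ)
    (hab : ComplexGradient.IsAbelianSystem ρ) (p : M) :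
    ∃ e ∈ IsManifold.maximalAtlas 𝓘(ℂ, EuclideanSpace ℂ (Fin (n + k))) ω M,
      p ∈ e.source ∧
      (∀ α : Fin k, ComplexGradient.IsPartialT e α (ρ (EuclideanSpace.single α 1))) ∧
      ∃ F : EuclideanSpace ℂ (Fin n) → EuclideanSpace ℝ (Fin k),
        ContDiffOn ℝ ∞ F (ComplexGradient.zPart '' e.target) ∧
        ∀ q ∈ e.source,
          U q = F (ComplexGradient.zPart (e q)) - ComplexGradient.uPart (e q) := by
  let c := chartAt (EuclideanSpace ℂ (Fin (n + k))) p
  have hc : c ∈ IsManifold.maximalAtlas 𝓘(ℂ, EuclideanSpace ℂ (Fin (n + k))) ω M :=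
    IsManifold.chart_mem_maximalAtlas p
  have hpc : p ∈ c.source := mem_chart_source _ p
  have hcM := contMDiffOn_of_mem_maximalAtlas hc
  have hcM' := contMDiffOn_symm_of_mem_maximalAtlas hc
  obtain ⟨Φ, hpΦ, hΦs, hΦ, hΦ', hder, F, hF, hUF⟩ :=
    (hsys.isLocalGradientSystem hhol hc).exists_coordinates (c.map_source hpc)
  -- No part of the polydisc is lost, because Φ lands in the target of c; F is thus smooth on
  -- exactly the set of values of z.
  have htgt : (c.trans Φ.symm).target = Φ.source := by
    rw [OpenPartialHomeomorph.trans_target]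
    exact inter_eq_left.2 fun y hy => hΦs (Φ.map_source hy)
  refine ⟨c.trans Φ.symm, ?_, ⟨hpc, hpΦ⟩, fun α q hq => ?_, F, htgt ▸ hF, fun q hq => ?_⟩
  · refine OpenPartialHomeomorph.mem_maximalAtlas_of_contMDiffOn _ ?_ ?_
    · exact (contMDiffOn_iff_contDiffOn.2 hΦ').comp (hcM.mono inter_subset_left)
        fun q hq => hq.2
    · rw [htgt]
      exact hcM'.comp (contMDiffOn_iff_contDiffOn.2 hΦ) fun y hy => hΦs (Φ.map_source hy)
  · have hqc : q ∈ c.source := hq.1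
    have hqΦ : c q ∈ Φ.target := hq.2
    have hs := Φ.map_target hqΦ
    have h1 : DifferentiableAt ℂ Φ.symm (c q) :=
      (hΦ'.contDiffAt (Φ.open_target.mem_nhds hqΦ)).differentiableAt (by simp)
    have h2 : DifferentiableAt ℂ Φ (Φ.symm (c q)) :=
      (hΦ.contDiffAt (Φ.open_source.mem_nhds hs)).differentiableAt (by simp)
    have hcq : MDifferentiableAt 𝓘(ℝ, EuclideanSpace ℂ (Fin (n + k)))
        𝓘(ℝ, EuclideanSpace ℂ (Fin (n + k))) c q :=
      ((contMDiffOn_of_mem_maximalAtlas (ComplexGradient.mem_maximalAtlas_real hc)).contMDiffAt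
        (c.open_source.mem_nhds hqc)).mdifferentiableAt (by simp)
    have h3 := (h1.hasFDerivAt.restrictScalars ℝ).hasMFDerivAt.comp q hcq.hasMFDerivAt
    have h4 : mfderiv 𝓘(ℝ, EuclideanSpace ℂ (Fin (n + k)))
        𝓘(ℝ, EuclideanSpace ℂ (Fin (n + k))) (c.trans Φ.symm) q = _ := h3.mfderiv
    rw [h4]
    have h5 := hder _ hs α
    rw [Φ.right_inv hqΦ, ComplexGradient.chartField_apply, c.left_inv hqc] at h5
    change fderiv ℂ Φ.symm (c q) _ = _
    refine (congrArg (fderiv ℂ Φ.symm (c q)) h5.symm).trans ?_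
    -- Since dΦ sends ∂/∂t_α to X_α, the inverse differential sends X_α back, by the chain rule for
    -- Φ⁻¹ ∘ Φ = id.
    have h6 : HasFDerivAt (Φ.symm ∘ Φ) _ (Φ.symm (c q)) :=
      HasFDerivAt.comp (Φ.symm (c q)) (by rw [Φ.right_inv hqΦ]; exact h1.hasFDerivAt)
        h2.hasFDerivAt
    have h7 := (hasFDerivAt_id (𝕜 := ℂ) (Φ.symm (c q))).congr_of_eventuallyEq
      (f₁ := Φ.symm ∘ Φ) (mem_of_superset (Φ.open_source.mem_nhds hs) fun y hy => Φ.left_inv hy)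
    exact congrArg (fun L : EuclideanSpace ℂ (Fin (n + k)) →L[ℂ] _ =>
      L (ComplexGradient.tVector α)) (h6.unique h7)
  · have hqΦ : c q ∈ Φ.target := hq.2
    have h1 := hUF _ (Φ.map_target hqΦ)
    rw [Φ.right_inv hqΦ] at h1
    exact (congrArg U (c.left_inv hq.1).symm).trans h1
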